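/- **Candidate spectral data.** Let $-\infty\le g_-\le g_+\le\infty$ (with at least one integer $k$ satisfying $g_-\le k\le g_+$), and let $\{E_{2k-1},E_{2k},\gamma_k,\sigma_k\}_{g_-\le k\le g_+}$ be real numbers $E_j,\gamma_k$ and signs $\sigma_k\in\{-1,0,1\}$ such that * the $E_j$, $2g_--1\le j\le 2g_+$, are strictly increasing in $j$, and $\gamma_k\in[E_{2k-1},E_{2k}]$; * $R:=\sup_k (E_{2k}-E_{2k-1})<\infty$; * if $g_-$ and $g_+$ are both finite, there are $N$ and $C>0$ with $|E_n|>Cn^2$ for all indices $n$ with $|n|>N$ (automatic); * if $g_-$ or $g_+$ is infinite, there is $N>0$ such that the open discs $D_k$ of radius $R$ centered at $\frac12(E_{2k-1}+E_{2k})$, $|k|\ge N$, are pairwise disjoint. The closed intervals $[E_{2k-1},E_{2k}]$, $g_-\le k\le g_+$, are the gaps. The bands are $[E_{2n-2},E_{2n-1}]$ for $g_-\le n\le g_++1$, with $E_{2g_--2}=-\infty$ and $E_{2g_++1}=+\infty$. Put $\mathcal D=\mathbb C\setminus(\mathbb R\cup\bigcup_k\overline{D_k})$. For open $\Omega$, $\mathcal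 A_2(\Omega)$ is the set of holomorphic $f$ on $\Omega$ with $|f(z)|\le Me^{c|z|^2}$ on $\Omega$ for some $c,M>0$. **Normalization.** Let $w_a(z)=(1-z/a)e^{z/a}$ for $a\ne0$ and $w_0(z)=z$. Put $f^{\pm}(z)=\prod_{\sigma_k=\pm1}w_{\gamma_k}(z)$. If some $\sigma_k=0$, let $\gamma_*$ be a value of $\gamma_k$ with $\sigma_k=0$ closest to $0$ (fixed if there are two), and let $m(y)$ be the number of $k$ with $\sigma_k=0$ and $\gamma_*\le\gamma_k\le y$ if $y\ge\gamma_*$, respectively $y<\gamma_k<\gamma_*$ if $y<\gamma_*$; otherwise $m\equiv0$. Off the real axis let $p=\big(\prod_{\sigma_k=0}w_{\gamma_k}\big)^{1/2}$ and $h=\big(\prod_{k}w_{E_{2k-1}}w_{E_{2k}}\big)^{1/4}$. In $\operatorname{Im}z>0$ they are products of principal roots (the root of $w_a$ being $(1-z/a)^{1/n}e^{z/(na)}$, or $z^{1/n}$ if $a=0$). In $\operatorname{Im}z<0$ the branches are such that the ratio $p/h$ has the boundary behavior given by $p_- /p_+=(-1)^{m}$ on $\mathbb R$, and $h_- /h_+=(-1)^{n-1}i$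 on $(E_{2n-2},E_{2n-1})$, $h_- /h_+=(-1)^n$ on $(E_{2n-1},E_{2n})$, where $\pm$ denote boundary values from above and below. With $s=e^{i\pi/4}p/(\sqrt2\,h)$ put $$B=i\,s\,\mathrm{diag}(f^-,f^+)\ \ (\operatorname{Im}z>0),\qquad B=s\,\mathrm{diag}(f^+,f^-)\ \ (\operatorname{Im}z<0).$$ Let $\sigma_1=\begin{pmatrix}0&1\\1&0\end{pmatrix}$, $\sigma_3=\mathrm{diag}(1,-1)$, $U=\begin{pmatrix}1&1\\-i&i\end{pmatrix}$. **Matrix Riemann–Hilbert problem (RHP 2), with real parameters $x,t$.** Find a $2\times2$ matrix function $\Phi(x,t,\cdot)$ such that 1. $\Phi$ is holomorphic in $\mathbb C\setminus\mathbb R$; 2. $\Phi$ has continuous boundary values $\Phi^\pm$ on $\mathbb R\setminus\{E_j\}$ from above and below, and its entries are $O(|z-E_j|^{-1/4})$ near each $E_j$; 3. $\Phi^+=\Phi^-V$ on $\mathbb R\setminus\{E_j\}$, where $V=(-1)^{n+m(z)}\mathrm{diag}(f^- /f^+,f^+/f^-)$ on the $n$-th band and $V=(-1)^{n+m(z)}\,i\,e^{-2izx\sigma_3-4iz^2t\sigma_3}\sigma_1$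 on the $n$-th gap; 4. $\Phi=U(I+O(1/z))B$ as $z\to\infty$ in each set $\{|\operatorname{Im}z|\ge\varepsilon|z|\}$, $\varepsilon>0$; 5. there are $c,M>0$ with $|\Phi_{ij}(x,t,z)|\le Me^{c|z|^2}$ for $z\in\mathcal D$. **Theorem.** Given candidate spectral data, let $\Phi(x,t,z)$ solve RHP 2 for all $x,t\in\mathbb R$, and suppose that $\Phi$ determines $q:\mathbb R^2\to\mathbb C$ through $$\begin{pmatrix}0&q(x,t)\\ \overline{q(x,t)}&0\end{pmatrix}=\lim_{z\to\infty} iz\,[\sigma_3,\,U^{-1}\Phi(x,t,z)B(z)^{-1}],$$ the limit being taken in each set $\{|\operatorname{Im}z|\ge\varepsilon|z|\}$, $\varepsilon>0$. Let $L_1>0$. If there is a function $r_1$ such that * (i) $r_1$ is holomorphic in the complement of the union of the (closed) gaps, with continuous boundary values $r_{1\pm}$ from above and below on the gaps, endpoints included; * (ii) $r_{1+}=r_{1-}^{-1}$ on the gaps; * (iii) $r_1(z)=e^{izL_1}(1+O(1/z))$ as $z\to\infty$ in the complement of the gaps; * (iv) $r_1\in\mathcal A_2(\mathcal D)$; then $q(x+L_1,t)=q(x,t)$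 for all $x,t\in\mathbb R$. -/

import Mathlib

open Complex Set Filter Topology Asymptotics

noncomputable section

namespace DiracRHP

/-- Phragmen-Lindelof algebra: holomorphic functions on the open set `Ω` with
`|f z| ≤ M exp (c |z| ^ p)` on `Ω`. -/
def PLAlgebra (p : ℝ) (Ω : Set ℂ) : Set (ℂ → ℂ) :=
  {f | DifferentiableOn ℂ f Ω ∧
    ∃ c M : ℝ, 0 < c ∧ 0 < M ∧ ∀ z ∈ Ω, ‖f z‖ ≤ M * Real.exp (c * ‖z‖ ^ p)}

/-- The raw data `g₋`, `g₊`, `E`, `γ`, `σ`. Only the values `E (2k-1)`, `E (2k)`, `γ k`, `σ k`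
with `g₋ ≤ k ≤ g₊` are ever used; `gm = ⊥` means `g₋ = -∞` and `gp = ⊤` means `g₊ = +∞`. -/
structure SpectralData where
  gm : WithBot ℤ
  gp : WithTop ℤ
  E : ℤ → ℝ
  γ : ℤ → ℝ
  σ : ℤ → SignType

namespace SpectralData

variable (S : SpectralData)

/-- Indices of the gaps, `g₋ ≤ k ≤ g₊`. -/
def gapIdx : Set ℤ := {k | S.gm ≤ (k : WithBot ℤ) ∧ (k : WithTop ℤ) ≤ S.gp}

/-- Indices of the band edges, `2 g₋ - 1 ≤ j ≤ 2 g₊`. -/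
def edgeIdx : Set ℤ := {j | ∃ k ∈ S.gapIdx, j = 2 * k - 1 ∨ j = 2 * k}

/-- The set of band edges. -/
def edges : Set ℝ := S.E '' S.edgeIdx

/-- The closed gap `[E_{2k-1}, E_{2k}]`. -/
def gap (k : ℤ) : Set ℝ := Icc (S.E (2 * k - 1)) (S.E (2 * k))

/-- The interior of the `n`-th band `[E_{2n-2}, E_{2n-1}]`, where `E_{2 g₋ - 2} = -∞` and
`E_{2 g₊ + 1} = +∞`. -/
def bandInterior (n : ℤ) : Set ℝ :=
  {y | (n - 1 ∈ S.gapIdx ∨ n ∈ S.gapIdx) ∧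
    (n - 1 ∈ S.gapIdx → S.E (2 * n - 2) < y) ∧ (n ∈ S.gapIdx → y < S.E (2 * n - 1))}

/-- The union of the gaps. -/
def gaps : Set ℝ := ⋃ k ∈ S.gapIdx, S.gap k

/-- The largest gap length `R`. -/
def R : ℝ := ⨆ k : S.gapIdx, (S.E (2 * k) - S.E (2 * k - 1))

/-- The midpoint of the `k`-th gap. -/
def center (k : ℤ) : ℂ := (((S.E (2 * k) + S.E (2 * k - 1)) / 2 : ℝ) : ℂ)

/-- The open disc `D_k`. -/
def disc (k : ℤ) : Set ℂ := Metric.ball (S.center k) S.R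

/-- The complement of the real axis and of all the closed discs. -/
def domainD : Set ℂ := (range ((↑) : ℝ → ℂ) ∪ ⋃ k ∈ S.gapIdx, Metric.closedBall (S.center k) S.R)ᶜ

/-- The conditions defining candidate spectral data. -/
structure IsCandidate : Prop where
  nonempty : S.gapIdx.Nonempty
  strictMono : StrictMonoOn S.E S.edgeIdx
  dirichlet_mem : ∀ k ∈ S.gapIdx, S.γ k ∈ S.gap k
  bddGaps : BddAbove (range fun k : S.gapIdx => S.E (2 * k) - S.E (2 * k - 1))
  growth : S.gm ≠ ⊥ → S.gp ≠ ⊤ →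
    ∃ (N : ℕ) (C : ℝ), 0 < C ∧ ∀ n ∈ S.edgeIdx, (N : ℤ) < |n| → C * (n : ℝ) ^ 2 < |S.E n|
  disjointDiscs : S.gm = ⊥ ∨ S.gp = ⊤ →
    ∃ N : ℕ, 0 < N ∧ {k ∈ S.gapIdx | (N : ℤ) ≤ |k|}.PairwiseDisjoint S.disc

/-! ### The counting function and the normalizing matrix -/

/-- Indices of the gaps with `σ_k = 0`. -/
def zeroIdx : Set ℤ := {k ∈ S.gapIdx | S.σ k = 0}

open Classical in
/-- A value of `γ_k` with `σ_k = 0` closest to zero. -/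
def gammaStar : ℝ :=
  if h : ∃ k ∈ S.zeroIdx, ∀ l ∈ S.zeroIdx, |S.γ k| ≤ |S.γ l| then S.γ h.choose else 0

open Classical in
/-- The counting function `m`; it vanishes when no `σ_k` is zero. -/
def m (y : ℝ) : ℕ :=
  if S.gammaStar ≤ y then {k ∈ S.zeroIdx | S.gammaStar ≤ S.γ k ∧ S.γ k ≤ y}.ncard
  else {k ∈ S.zeroIdx | y < S.γ k ∧ S.γ k < S.gammaStar}.ncard

open Classical in
/-- The elementary factor `(1 - z/a) exp (z/a)`, to be replaced by `z` when `a = 0`. -/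
def factor (a : ℝ) (z : ℂ) : ℂ := if a = 0 then z else (1 - z / a) * exp (z / a)

open Classical in
/-- The branch of the `n`-th root of `factor a` which is given by the principal branch of
`(1 - z/a)^(1/n)` (of `z^(1/n)` when `a = 0`). It is holomorphic off the real axis. -/
def factorRoot (n : ℕ) (a : ℝ) (z : ℂ) : ℂ :=
  if a = 0 then z ^ (1 / n : ℂ) else (1 - z / a) ^ (1 / n : ℂ) * exp (z / (n * a))

open Classical in
/-- `f⁺`. -/
def fPlus (z : ℂ) : ℂ := ∏' k : ℤ, if k ∈ S.gapIdx ∧ S.σ k = 1 then factor (S.γ k) z else 1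

open Classical in
/-- `f⁻`. -/
def fMinus (z : ℂ) : ℂ := ∏' k : ℤ, if k ∈ S.gapIdx ∧ S.σ k = -1 then factor (S.γ k) z else 1

open Classical in
/-- A branch, off the real axis, of the square root of the product of the factors of the `γ_k`
with `σ_k = 0`. -/
def pRoot (z : ℂ) : ℂ := ∏' k : ℤ, if k ∈ S.zeroIdx then factorRoot 2 (S.γ k) z else 1

open Classical in
/-- A branch, off the real axis, of the fourth root of the product of the factors of the band
edges. -/
def hRoot (z : ℂ) : ℂ :=
  ∏' k : ℤ, if k ∈ S.gapIdx then
    factorRoot 4 (S.E (2 * k - 1)) z * factorRoot 4 (S.E (2 * k)) z else 1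

open Classical in
/-- The index of the first positive band edge (one more than the last index if there is none). -/
def firstPosEdge : ℤ :=
  if (∃ j ∈ S.edgeIdx, 0 < S.E j) then sInf {j ∈ S.edgeIdx | 0 < S.E j} else sSup S.edgeIdx + 1

/-- The scalar prefactor `e^{iπ/4} p / (√2 h)`. `pRoot` and `hRoot` are both continuous across the
real axis immediately to the right of the origin; the constant in the lower half plane makes the
boundary values of `p = √(∏ ..)` and `h = (∏ ..)^{1/4}` satisfy `p₋ / p₊ = (-1)^m`, and
`h₋ / h₊ = (-1)^(n-1) i` on the `n`-th band and `h₋ / h₊ = (-1)^n` on the `n`-th gap. -/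
def scalarB (z : ℂ) : ℂ :=
  exp (I * Real.pi / 4) / (Real.sqrt 2 : ℂ) * (S.pRoot z / S.hRoot z) *
    (if 0 < z.im then 1 else (-1) ^ S.m 0 * I ^ (-S.firstPosEdge))

/-- The matrix `B`, for `z` off the real axis. -/
def B (z : ℂ) : Matrix (Fin 2) (Fin 2) ℂ :=
  if 0 < z.im then (I * S.scalarB z) • !![S.fMinus z, 0; 0, S.fPlus z]
  else S.scalarB z • !![S.fPlus z, 0; 0, S.fMinus z]

end SpectralData

/-! ### The Riemann-Hilbert problem -/

def sigma1 : Matrix (Fin 2) (Fin 2) ℂ := !![0, 1; 1, 0]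

def sigma3 : Matrix (Fin 2) (Fin 2) ℂ := !![1, 0; 0, -1]

/-- `exp (a σ₃)`. -/
def expSigma3 (a : ℂ) : Matrix (Fin 2) (Fin 2) ℂ := !![exp a, 0; 0, exp (-a)]

def U : Matrix (Fin 2) (Fin 2) ℂ := !![1, 1; -I, I]

/-- `z → ∞` within the two sectors `|Im z| ≥ ε |z|`. -/
def sectorAtInfty (ε : ℝ) : Filter ℂ := Bornology.cobounded ℂ ⊓ 𝓟 {z | ε * ‖z‖ ≤ |z.im|}

def upper : Set ℂ := {z | 0 < z.im}

def lower : Set ℂ := {z | z.im < 0}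

namespace SpectralData

variable (S : SpectralData)

/-- The jump matrix on the `n`-th band. -/
def bandJump (n : ℤ) (y : ℝ) : Matrix (Fin 2) (Fin 2) ℂ :=
  (-1 : ℂ) ^ (n + (S.m y : ℤ)) • !![S.fMinus y / S.fPlus y, 0; 0, S.fPlus y / S.fMinus y]

/-- The jump matrix on the `n`-th gap. -/
def gapJump (x t : ℝ) (n : ℤ) (y : ℝ) : Matrix (Fin 2) (Fin 2) ℂ :=
  ((-1 : ℂ) ^ (n + (S.m y : ℤ)) * I) •
    (expSigma3 (-2 * I * y * x - 4 * I * (y : ℂ) ^ 2 * t) * sigma1)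

/-- `Φ` (a function of `z` off the real axis) solves the time-dependent Riemann-Hilbert problem
with parameters `x` and `t`. -/
structure SolvesRHP (x t : ℝ) (Φ : ℂ → Matrix (Fin 2) (Fin 2) ℂ) : Prop where
  holo : ∀ i j, DifferentiableOn ℂ (fun z => Φ z i j) (upper ∪ lower)
  boundary : ∃ Φp Φm : ℝ → Matrix (Fin 2) (Fin 2) ℂ,
    ContinuousOn Φp S.edgesᶜ ∧ ContinuousOn Φm S.edgesᶜ ∧
    (∀ y ∈ S.edgesᶜ, Tendsto Φ (𝓝[upper] (y : ℂ)) (𝓝 (Φp y)) ∧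
      Tendsto Φ (𝓝[lower] (y : ℂ)) (𝓝 (Φm y))) ∧
    (∀ n, ∀ y ∈ S.bandInterior n, Φp y = Φm y * S.bandJump n y) ∧
    (∀ n ∈ S.gapIdx, ∀ y ∈ interior (S.gap n), Φp y = Φm y * S.gapJump x t n y)
  quartic : ∀ e ∈ S.edges, ∀ i j,
    (fun z => Φ z i j) =O[𝓝[upper ∪ lower] (e : ℂ)] fun z => ‖z - e‖ ^ (-(1 / 4) : ℝ)
  asymp : ∀ ε : ℝ, 0 < ε → ∀ i j,
    (fun z => (U⁻¹ * Φ z * (S.B z)⁻¹ - 1) i j) =O[sectorAtInfty ε] fun z => z⁻¹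
  growth : ∃ c M : ℝ, 0 < c ∧ 0 < M ∧
    ∀ z ∈ S.domainD, ∀ i j, ‖Φ z i j‖ ≤ M * Real.exp (c * ‖z‖ ^ 2)

/-- The matrix potential with entries `q` and `q^*` is recovered from `Φ`. -/
def Reconstructs (Φ : ℂ → Matrix (Fin 2) (Fin 2) ℂ) (q : ℂ) : Prop :=
  ∀ ε : ℝ, 0 < ε →
    Tendsto (fun z => (I * z) • ⁅sigma3, U⁻¹ * Φ z * (S.B z)⁻¹⁆) (sectorAtInfty ε)
      (𝓝 !![0, q; (starRingEnd ℂ) q, 0])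

/-- `r` solves the scalar Riemann-Hilbert problem with `r ~ exp (i z L₁)` at infinity. -/
structure SolvesScalarRHP (L₁ : ℝ) (r : ℂ → ℂ) : Prop where
  holo : DifferentiableOn ℂ r (((↑) : ℝ → ℂ) '' S.gaps)ᶜ
  boundary : ∃ rp rm : ℝ → ℂ, ContinuousOn rp S.gaps ∧ ContinuousOn rm S.gaps ∧
    (∀ y ∈ S.gaps, Tendsto r (𝓝[upper] (y : ℂ)) (𝓝 (rp y)) ∧
      Tendsto r (𝓝[lower] (y : ℂ)) (𝓝 (rm y))) ∧
    ∀ y ∈ S.gaps, rp y * rm y = 1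
  asymp : (fun z => r z * exp (-(I * z * L₁)) - 1)
    =O[Bornology.cobounded ℂ ⊓ 𝓟 (((↑) : ℝ → ℂ) '' S.gaps)ᶜ] fun z => z⁻¹
  growth : r ∈ PLAlgebra 2 S.domainD

end SpectralData

end DiracRHP

end

noncomputable section

open Complex Set Filter Topology Asymptotics

namespace DiracRHP

/-! ### Holomorphic functions off the real axis -/

/-! Put a(z) = r(z) e^{-izL₁}. It tends to 1 at infinity, has no jump on the bands, and satisfies
a₊a₋ = e^{-2izL₁} on the gaps. The jump matrices on the gaps are antidiagonal, and shifting x by L₁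
changes them by exactly this exponential. So Φ(x+L₁)diag(a, 1/a) has the jumps and the normalization
of Φ(x). If the two are equal (`SolvesRHP.mul_diagInv_eq`), then q(x+L₁) = q(x): the diagonal factor
commutes with σ₃ and B and tends to the identity. Four ingredients are needed.

No zeros of r. The function g(z) = r(z) conj r(conj z) tends to 1 at infinity, its boundary values
on the gaps are unimodular and mutually inverse, and it equals 1 at the band edges. If the gaps are
bounded, the maximum principle gives g = 1; otherwise g + 1/g continues analytically to infinity and
takes the value 2 at edges accumulating there (`IsSymmetricUnimodular.eq_one`).

Short gaps. Since r₊r₋ = 1 while r ~ e^{izL₁}, the function e^{-2iyL₁} is 1 + O(1/y) on the gaps, so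
the length of the k-th gap is O(1/|k|) (`SolvesScalarRHP.exists_length_le`).

Size of det B. Its square compares the product of the factors of the γ_k with that of the band
edges. Short gaps make the quotient bounded in the sectors |z| ≤ 2|Im z|, up to an exponential
e^{Cz} (`IsCandidate.exists_norm_det_B_le`).

Uniqueness. The matrix e^{Cz}Φ(x+L₁)diag(a, 1/a)adj Φ(x) has no jumps, its singularities at the
edges are removable, it grows with order at most two, and it is bounded in the sectors.
Phragmén–Lindelöf and Liouville make it constant (`SolvesRHP.exists_eq_const`). The adjugate
replaces the inverse because invertibility of Φ is only known afterwards: the same argument with a =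
1 and L₁ = 0 shows that e^{Cz}det Φ is constant, and behavior at infinity shows that it is nonzero.
-/

/-- The complement of the real axis. -/
def nonreal : Set ℂ := {z | z.im ≠ 0}

lemma isOpen_nonreal : IsOpen nonreal := isOpen_ne_fun continuous_im continuous_const

lemma upper_union_lower : upper ∪ lower = nonreal := by
  ext z
  simp only [upper, lower, nonreal, mem_union, mem_ofPred_eq, ne_iff_lt_or_gt]
  tauto

lemma closure_upper : closure upper = {z | 0 ≤ z.im} := Complex.closure_setOfPred_lt_im 0

lemma closure_lower : closure lower = {z | z.im ≤ 0} := Complex.closure_setOfPred_im_lt 0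

lemma closure_nonreal : closure nonreal = univ := by
  rw [← upper_union_lower, closure_union, closure_upper, closure_lower]
  ext z
  simpa using le_total 0 z.im

lemma nhdsWithin_nonreal (z : ℂ) : 𝓝[nonreal] z = 𝓝[upper] z ⊔ 𝓝[lower] z := by
  rw [← upper_union_lower, nhdsWithin_union]

instance (z : ℂ) : (𝓝[nonreal] z).NeBot :=
  mem_closure_iff_nhdsWithin_neBot.mp (by simp [closure_nonreal])

instance (y : ℝ) : (𝓝[upper] (y : ℂ)).NeBot :=
  mem_closure_iff_nhdsWithin_neBot.mp (by simp [closure_upper])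

instance (y : ℝ) : (𝓝[lower] (y : ℂ)).NeBot :=
  mem_closure_iff_nhdsWithin_neBot.mp (by simp [closure_lower])

lemma nonreal_mem_nhds {z : ℂ} (hz : z.im ≠ 0) : nonreal ∈ 𝓝 z := isOpen_nonreal.mem_nhds hz

/-- A continuous function that is holomorphic off the real axis is holomorphic. -/
theorem differentiableOn_of_continuousOn_of_nonreal {U : Set ℂ} (hU : IsOpen U) {f : ℂ → ℂ}
    (hc : ContinuousOn f U) (hd : ∀ z ∈ U, z.im ≠ 0 → DifferentiableAt ℂ f z) :
    DifferentiableOn ℂ f U := by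
  refine (isConservativeOn_and_continuousOn_iff_isDifferentiableOn hU).mp ⟨fun z w hzw => ?_, hc⟩
  rw [← add_eq_zero_iff_eq_neg, wedgeIntegral_add_wedgeIntegral_eq]
  have key : ∀ a b c d : ℝ, uIcc a b ×ℂ uIcc c d ⊆ U → (0 ∉ Ioo (min c d) (max c d)) →
      (∫ x : ℝ in a..b, f (x + c * I)) - (∫ x : ℝ in a..b, f (x + d * I)) +
      I • (∫ y : ℝ in c..d, f (b + y * I)) - I • (∫ y : ℝ in c..d, f (a + y * I)) = 0 := by
    intro a b c d hsub h0
    have h := integral_boundary_rect_eq_zero_of_continuousOn_of_differentiableOn f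
      (a + c * I) (b + d * I) (by simpa using hc.mono hsub) ?_
    · simpa using h
    · intro v hv
      simp only [add_re, ofReal_re, mul_re, I_re, mul_zero, ofReal_im, I_im, mul_one, sub_self,
        add_zero, add_im, mul_im, zero_add] at hv
      refine (hd v (hsub ⟨?_, ?_⟩) fun h => h0 (h ▸ hv.2)).differentiableWithinAt
      · exact Ioo_subset_Icc_self hv.1
      · exact Ioo_subset_Icc_self hv.2
  have hzw' : uIcc z.re w.re ×ℂ uIcc z.im w.im ⊆ U := hzw
  -- Morera's theorem: a rectangle crossing the real axis is cut along it. Cauchy's theorem on each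
  -- half needs only continuity up to the boundary, and the two integrals along the cut cancel.
  by_cases h0 : 0 ∈ Ioo (min z.im w.im) (max z.im w.im)
  · have h0' : (0 : ℝ) ∈ uIcc z.im w.im := Ioo_subset_Icc_self h0
    have s1 : uIcc z.im 0 ⊆ uIcc z.im w.im := uIcc_subset_uIcc_left h0'
    have s2 : uIcc 0 w.im ⊆ uIcc z.im w.im := uIcc_subset_uIcc_right h0'
    have k1 := key z.re w.re z.im 0 (fun v hv => hzw' ⟨hv.1, s1 hv.2⟩) (by
      intro h; rcases le_total z.im 0 with h' | h' <;> simp [h'] at h)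
    have k2 := key z.re w.re 0 w.im (fun v hv => hzw' ⟨hv.1, s2 hv.2⟩) (by
      intro h; rcases le_total w.im 0 with h' | h' <;> simp [h'] at h)
    have int : ∀ a ∈ uIcc z.re w.re, ∀ c d : ℝ, uIcc c d ⊆ uIcc z.im w.im →
        IntervalIntegrable (fun y : ℝ => f (a + y * I)) MeasureTheory.volume c d := by
      intro a ha c d hcd
      refine ContinuousOn.intervalIntegrable (hc.comp (by fun_prop) fun y hy => hzw' ⟨?_, ?_⟩)
      · simpa using ha
      · simpa using hcd hy
    rw [← intervalIntegral.integral_add_adjacent_intervals (int _ right_mem_uIcc _ _ s1)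
      (int _ right_mem_uIcc _ _ s2), ← intervalIntegral.integral_add_adjacent_intervals
      (int _ left_mem_uIcc _ _ s1) (int _ left_mem_uIcc _ _ s2)]
    have := congrArg₂ (· + ·) k1 k2
    simp only [smul_add, add_zero] at this ⊢
    linear_combination this
  · exact key _ _ _ _ hzw' h0

theorem extendFrom_nonreal_eq {U : Set ℂ} {f : ℂ → ℂ}
    (hd : ∀ z ∈ U, z.im ≠ 0 → DifferentiableAt ℂ f z) {z : ℂ} (hz : z ∈ U) (h : z.im ≠ 0) :
    extendFrom nonreal f z = f z :=
  extendFrom_eq (by simp [closure_nonreal]) ((hd z hz h).continuousAt.tendsto.mono_left inf_le_left)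

/-- A function that is holomorphic off the real axis and has limits at the points of the real
axis extends holomorphically. -/
theorem differentiableOn_extendFrom_nonreal {U : Set ℂ} (hU : IsOpen U) {f : ℂ → ℂ}
    (hd : ∀ z ∈ U, z.im ≠ 0 → DifferentiableAt ℂ f z)
    (hl : ∀ y : ℝ, (y : ℂ) ∈ U → ∃ l, Tendsto f (𝓝[nonreal] (y : ℂ)) (𝓝 l)) :
    DifferentiableOn ℂ (extendFrom nonreal f) U := by
  refine differentiableOn_of_continuousOn_of_nonreal hU
    (continuousOn_extendFrom (by simp [closure_nonreal]) fun z hz => ?_) fun z hz h => ?_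
  · by_cases h : z.im = 0
    · obtain ⟨y, rfl⟩ : ∃ y : ℝ, (y : ℂ) = z := ⟨z.re, Complex.ext (by simp) (by simp [h])⟩
      exact hl y hz
    · exact ⟨_, (hd z hz h).continuousAt.tendsto.mono_left inf_le_left⟩
  · refine (hd z hz h).congr_of_eventuallyEq ?_
    filter_upwards [hU.mem_nhds hz, nonreal_mem_nhds h] with w hw hw'
    exact extendFrom_nonreal_eq hd hw hw'

lemma real_or_nonreal (z : ℂ) : (∃ y : ℝ, (y : ℂ) = z) ∨ z.im ≠ 0 := by
  by_cases h : z.im = 0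
  · exact .inl ⟨z.re, Complex.ext (by simp) (by simp [h])⟩
  · exact .inr h

/-- A function that is holomorphic off the real axis, has limits at the points of the real axis
outside a discrete set, and grows at most like the inverse of a square root at the points of this
set, extends to an entire function. -/
theorem exists_entire_extension {f : ℂ → ℂ} {Z : Set ℝ}
    (hd : ∀ z : ℂ, z.im ≠ 0 → DifferentiableAt ℂ f z)
    (hl : ∀ y : ℝ, y ∉ Z → ∃ l, Tendsto f (𝓝[nonreal] (y : ℂ)) (𝓝 l))
    (hZ : ∀ e ∈ Z, ∀ᶠ y in 𝓝[≠] e, y ∉ Z)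
    (hb : ∀ e ∈ Z, f =O[𝓝[nonreal] (e : ℂ)] fun z => ‖z - e‖ ^ (-(1 / 2) : ℝ)) :
    ∃ F : ℂ → ℂ, Differentiable ℂ F ∧ ∀ z : ℂ, z.im ≠ 0 → F z = f z := by
  refine ⟨extendFrom nonreal f, ?_, fun z hz => extendFrom_nonreal_eq (U := univ)
    (fun z _ => hd z) (mem_univ z) hz⟩
  rw [← differentiableOn_univ]
  refine differentiableOn_extendFrom_nonreal isOpen_univ (fun z _ => hd z) fun y _ => ?_
  by_cases hy : y ∈ Z
  swap
  · exact hl y hy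
  obtain ⟨ρ, hρ, hball⟩ := Metric.mem_nhdsWithin_iff.mp (hZ y hy)
  obtain ⟨C, hC⟩ := (hb y hy).bound
  obtain ⟨ρ', hρ', hball'⟩ := Metric.mem_nhdsWithin_iff.mp hC
  set δ := min ρ ρ'
  have hδ : 0 < δ := lt_min hρ hρ'
  set U : Set ℂ := Metric.ball (y : ℂ) δ \ {(y : ℂ)}
  have hU : IsOpen U := Metric.isOpen_ball.sdiff isClosed_singleton
  have hlim : ∀ u : ℝ, (u : ℂ) ∈ U → ∃ l, Tendsto f (𝓝[nonreal] (u : ℂ)) (𝓝 l) := by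
    intro u hu
    refine hl u (hball ⟨?_, ?_⟩)
    · have : dist (u : ℂ) y < δ := hu.1
      rw [Metric.mem_ball]
      calc dist u y = dist (u : ℂ) y := by rw [Complex.dist_eq, ← ofReal_sub, norm_real]; rfl
        _ < δ := this
        _ ≤ ρ := min_le_left _ _
    · exact fun h => hu.2 (by rw [mem_singleton_iff.mp h]; rfl)
  have hdiff := differentiableOn_extendFrom_nonreal hU (fun z _ => hd z) hlim
  set F := extendFrom nonreal f
  have hFf : ∀ z : ℂ, z.im ≠ 0 → F z = f z := fun z hz =>
    extendFrom_nonreal_eq (U := univ) (fun z _ => hd z) (mem_univ z) hz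
  have hUn : U ∈ 𝓝[≠] (y : ℂ) := by
    rw [show U = Metric.ball (y : ℂ) δ ∩ {(y : ℂ)}ᶜ from rfl]
    exact inter_mem (mem_nhdsWithin_of_mem_nhds (Metric.ball_mem_nhds _ hδ)) self_mem_nhdsWithin
  -- The growth bound is known off the real axis only; continuity of `F` carries it to the real
  -- points of the punctured disc.
  have hbound : ∀ z ∈ U, ‖F z‖ ≤ C * ‖z - y‖ ^ (-(1 / 2) : ℝ) := by
    intro z hz
    have t1 : Tendsto F (𝓝[nonreal] z) (𝓝 (F z)) :=
      ((hdiff.differentiableAt (hU.mem_nhds hz)).continuousAt.tendsto).mono_left inf_le_left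
    have hne : ‖z - y‖ ≠ 0 := norm_ne_zero_iff.mpr (sub_ne_zero.mpr hz.2)
    have t2 : Tendsto (fun w : ℂ => C * ‖w - y‖ ^ (-(1 / 2) : ℝ)) (𝓝[nonreal] z)
        (𝓝 (C * ‖z - y‖ ^ (-(1 / 2) : ℝ))) := by
      refine Tendsto.mono_left ?_ inf_le_left
      exact ((continuous_id.sub continuous_const).norm.continuousAt.rpow_const
        (.inl hne)).const_mul C
    refine le_of_tendsto_of_tendsto t1.norm t2 ?_
    filter_upwards [mem_nhdsWithin_of_mem_nhds (hU.mem_nhds hz), self_mem_nhdsWithin] with w hw hw'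
    have := hball' ⟨Metric.ball_subset_ball (min_le_right _ _) hw.1, hw'⟩
    rw [hFf w hw']
    simpa [abs_of_nonneg (Real.rpow_nonneg (norm_nonneg (w - y)) _)] using this
  have hO : (fun z => F z - F y) =o[𝓝[≠] (y : ℂ)] fun z => (z - y)⁻¹ := by
    have h1 : F =O[𝓝[≠] (y : ℂ)] fun z => ‖z - y‖ ^ (-(1 / 2) : ℝ) := by
      refine IsBigO.of_bound C ?_
      filter_upwards [hUn] with z hz
      rw [Real.norm_of_nonneg (Real.rpow_nonneg (norm_nonneg _) _)]
      exact hbound z hz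
    have tn : Tendsto (fun z : ℂ => ‖z - y‖) (𝓝[≠] (y : ℂ)) (𝓝[>] 0) := tendsto_norm_sub_self_nhdsNE _
    have h2 : (fun z : ℂ => ‖z - y‖ ^ (-(1 / 2) : ℝ)) =o[𝓝[≠] (y : ℂ)] fun z => (z - y)⁻¹ := by
      refine IsLittleO.of_norm_right ?_
      rw [isLittleO_iff_tendsto']
      · have : Tendsto (fun z : ℂ => ‖z - y‖ ^ (1 / 2 : ℝ)) (𝓝[≠] (y : ℂ)) (𝓝 0) := by
          have := (Real.continuousAt_rpow_const 0 (1 / 2 : ℝ) (.inr (by norm_num))).tendsto.comp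
            (tn.mono_right inf_le_left)
          simpa [Function.comp_def] using this
        refine this.congr' ?_
        filter_upwards [self_mem_nhdsWithin] with z hz
        have hpos : 0 < ‖z - y‖ := norm_pos_iff.mpr (sub_ne_zero.mpr hz)
        rw [norm_inv, div_inv_eq_mul]
        nth_rewrite 3 [← Real.rpow_one ‖z - y‖]
        rw [← Real.rpow_add hpos]
        norm_num
      · filter_upwards [self_mem_nhdsWithin] with z hz h
        exact absurd h (by simpa [sub_eq_zero] using hz)
    refine (h1.trans_isLittleO h2).sub ?_
    refine isLittleO_const_left.mpr (.inr ?_)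
    have : Tendsto (fun z : ℂ => ‖z - y‖⁻¹) (𝓝[≠] (y : ℂ)) atTop := tendsto_inv_nhdsGT_zero.comp tn
    exact this.congr fun z => by simp [norm_inv]
  have hlimF := tendsto_limUnder_of_differentiable_on_punctured_nhds_of_isLittleO
    (f := F) (c := (y : ℂ)) (by
      filter_upwards [hUn] with z hz using hdiff.differentiableAt (hU.mem_nhds hz)) hO
  refine ⟨_, (hlimF.mono_left (nhdsWithin_mono _ fun z hz => ?_)).congr' ?_⟩
  · rintro rfl
    exact hz (by simp)
  · filter_upwards [self_mem_nhdsWithin] with z hz using hFf z hz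

/-! ### A Phragmén–Lindelöf principle for order two -/

/-- A version of the Phragmen-Lindelöf principle: an entire function of order at most two that is
bounded in the sectors `‖z‖ ≤ 2 |Im z|` is constant. -/
theorem eq_of_order_two_of_bounded_in_sector {F : ℂ → ℂ} (hF : Differentiable ℂ F) {c M K : ℝ}
    (hM : ∀ z, ‖F z‖ ≤ M * Real.exp (c * ‖z‖ ^ 2)) (hc : 0 ≤ c)
    (hK : ∀ z : ℂ, ‖z‖ ≤ 2 * |z.im| → ‖F z‖ ≤ K) (z w : ℂ) : F z = F w := by
  have key : ∀ G : ℂ → ℂ, Differentiable ℂ G → (∀ z, ‖G z‖ ≤ M * Real.exp (c * ‖z‖ ^ 2)) →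
      (∀ z : ℂ, ‖z‖ ≤ 2 * |z.im| → ‖G z‖ ≤ K) → ∀ z : ℂ, 0 < z.re → ‖G z‖ ≤ K := by
    intro G hG hM hK z hz
    by_cases hz2 : ‖z‖ ≤ 2 * |z.im|
    · exact hK z hz2
    have hz0 : z ≠ 0 := by rintro rfl; simp at hz
    have hnorm : 0 < ‖z‖ := norm_pos_iff.mpr hz0
    have harg : |arg z| < Real.pi / 2 := abs_arg_lt_pi_div_two_iff.mpr (.inl hz)
    have hs : |Real.sin (arg z)| < 1 / 2 := by
      rw [Complex.sin_arg, abs_div, abs_of_pos hnorm, div_lt_iff₀ hnorm]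
      linarith
    rw [abs_lt] at hs harg
    have hpi := Real.pi_pos
    have h6 : Real.sin (Real.pi / 6) = 1 / 2 := Real.sin_pi_div_six
    have h1 : arg z ≤ Real.pi / 6 := by
      by_contra! h
      have := Real.strictMonoOn_sin (a := Real.pi / 6) (b := arg z) ⟨by linarith, by linarith⟩
        ⟨by linarith, by linarith⟩ h
      linarith
    have h2 : -(Real.pi / 6) ≤ arg z := by
      by_contra! h
      have := Real.strictMonoOn_sin (a := arg z) (b := -(Real.pi / 6)) ⟨by linarith, by linarith⟩
        ⟨by linarith, by linarith⟩ h
      rw [Real.sin_neg] at this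
      linarith
    have hbd : ∀ ζ : ℂ, |Real.sin ζ.im| = 1 / 2 → ‖G (exp ζ)‖ ≤ K := by
      intro ζ hζ
      refine hK _ ?_
      rw [exp_im, norm_exp, abs_mul, hζ, Real.abs_exp]
      linarith
    -- The remaining part of the right half plane is the sector |arg z| ≤ π/6, the image under `exp`
    -- of a strip of width π/3. Functions of order less than 3 are admissible there, and the order
    -- is 2.
    have := PhragmenLindelof.horizontal_strip (a := -(Real.pi / 6)) (b := Real.pi / 6) (C := K)
      (f := fun ζ => G (exp ζ)) (z := log z) (hG.comp Complex.differentiable_exp).diffContOnCl ?_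
      ?_ ?_ (by simpa [log_im] using h2) (by simpa [log_im] using h1)
    · simpa [exp_log hz0] using this
    · refine ⟨2, ?_, c, IsBigO.of_bound M (Eventually.of_forall fun ζ => ?_)⟩
      · rw [lt_div_iff₀ (by linarith)]
        linarith
      · refine (hM _).trans ?_
        rw [Real.norm_of_nonneg (Real.exp_nonneg _), norm_exp]
        have hM0 : 0 ≤ M := by
          have := (norm_nonneg _).trans (hM 0)
          simpa using this
        gcongr
        rw [← Real.exp_nat_mul]
        exact Real.exp_le_exp.mpr (by push_cast; linarith [le_abs_self ζ.re])
    · intro ζ hζ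
      exact hbd ζ (by rw [hζ, Real.sin_neg, h6]; norm_num)
    · intro ζ hζ
      exact hbd ζ (by rw [hζ, h6]; norm_num)
  have hall : ∀ z, ‖F z‖ ≤ K := by
    intro z
    rcases lt_trichotomy 0 z.re with h | h | h
    · exact key F hF hM hK z h
    · refine hK z ?_
      have : ‖z‖ ≤ |z.re| + |z.im| := norm_le_abs_re_add_abs_im z
      rw [← h, abs_zero] at this
      linarith [abs_nonneg z.im]
    · have := key (fun z => F (-z)) (hF.comp differentiable_neg) (fun z => by simpa using hM (-z))
        (fun z hz => hK _ (by simpa using hz)) (-z) (by simpa using h)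
      simpa using this
  exact hF.apply_eq_apply_of_bounded (isBounded_iff_forall_norm_le.mpr
    ⟨K, by rintro _ ⟨z, rfl⟩; exact hall z⟩) z w

end DiracRHP

namespace DiracRHP
namespace SpectralData

variable {S : SpectralData}

/-! ### Geometry of the gaps -/

lemma ordConnected_gapIdx : S.gapIdx.OrdConnected := by
  refine ⟨fun a ha b hb k hk => ⟨ha.1.trans ?_, le_trans ?_ hb.2⟩⟩
  · exact_mod_cast hk.1
  · exact_mod_cast hk.2

lemma left_mem_edgeIdx {k : ℤ} (hk : k ∈ S.gapIdx) : 2 * k - 1 ∈ S.edgeIdx := ⟨k, hk, .inl rfl⟩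

lemma right_mem_edgeIdx {k : ℤ} (hk : k ∈ S.gapIdx) : 2 * k ∈ S.edgeIdx := ⟨k, hk, .inr rfl⟩

lemma gap_subset_gaps {k : ℤ} (hk : k ∈ S.gapIdx) : S.gap k ⊆ S.gaps :=
  subset_biUnion_of_mem (u := fun k => S.gap k) hk

namespace IsCandidate

variable (hS : S.IsCandidate)
include hS

lemma left_lt_right {k : ℤ} (hk : k ∈ S.gapIdx) : S.E (2 * k - 1) < S.E (2 * k) :=
  hS.strictMono (left_mem_edgeIdx hk) (right_mem_edgeIdx hk) (by omega)

lemma right_lt_left {k l : ℤ} (hk : k ∈ S.gapIdx) (hl : l ∈ S.gapIdx) (h : k < l) :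
    S.E (2 * k) < S.E (2 * l - 1) :=
  hS.strictMono (right_mem_edgeIdx hk) (left_mem_edgeIdx hl) (by omega)

lemma left_mem_gap {k : ℤ} (hk : k ∈ S.gapIdx) : S.E (2 * k - 1) ∈ S.gap k :=
  left_mem_Icc.mpr (hS.left_lt_right hk).le

lemma right_mem_gap {k : ℤ} (hk : k ∈ S.gapIdx) : S.E (2 * k) ∈ S.gap k :=
  right_mem_Icc.mpr (hS.left_lt_right hk).le

lemma length_le {k : ℤ} (hk : k ∈ S.gapIdx) : S.E (2 * k) - S.E (2 * k - 1) ≤ S.R :=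
  le_ciSup hS.bddGaps ⟨k, hk⟩

lemma R_pos : 0 < S.R := by
  obtain ⟨k, hk⟩ := hS.nonempty
  linarith [hS.left_lt_right hk, hS.length_le hk]

/-- With finitely many gaps a large `N` leaves no index, so disjointness is vacuous and both cases
can be treated together. -/
lemma exists_pairwiseDisjoint :
    ∃ N : ℕ, {k ∈ S.gapIdx | (N : ℤ) ≤ |k|}.PairwiseDisjoint S.disc := by
  by_cases h : S.gm = ⊥ ∨ S.gp = ⊤
  · obtain ⟨N, -, hN⟩ := hS.disjointDiscs h
    exact ⟨N, hN⟩
  push Not at h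
  obtain ⟨a, ha⟩ := WithBot.ne_bot_iff_exists.mp h.1
  obtain ⟨b, hb⟩ := WithTop.ne_top_iff_exists.mp h.2
  refine ⟨a.natAbs + b.natAbs + 1, ?_⟩
  rintro k ⟨⟨h1, h2⟩, h3⟩
  rw [← ha, WithBot.coe_le_coe] at h1
  rw [← hb, WithTop.coe_le_coe] at h2
  push_cast at h3
  have := abs_le.mpr ⟨(by have := neg_abs_le a; have := abs_nonneg b; omega : -(|a| + |b|) ≤ k),
    (by have := le_abs_self b; have := abs_nonneg a; omega)⟩
  omega

omit hS in
-- Steps of size 2r give slope 2r; giving up half of it absorbs all constants. The spare -r leaves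
-- room to pass from the center of a gap to any of its points.
lemma linear_growth_of_separated {I : Set ℤ} (hI : I.OrdConnected) {c : ℤ → ℝ} {r : ℝ} (hr : 0 < r)
    {N : ℕ} (h : ∀ k ∈ I, k + 1 ∈ I → (N : ℤ) ≤ k → c k + 2 * r ≤ c (k + 1)) :
    ∃ N' : ℕ, ∀ k ∈ I, (N' : ℤ) ≤ k → r * k ≤ c k - r := by
  by_cases h0 : ∃ k ∈ I, (N : ℤ) ≤ k
  swap
  · exact ⟨N, fun k hk hk' => absurd ⟨k, hk, hk'⟩ h0⟩
  obtain ⟨k0, hk0, hN⟩ := h0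
  have key : ∀ n : ℕ, k0 + n ∈ I → c k0 + 2 * r * n ≤ c (k0 + n) := by
    intro n
    induction n with
    | zero => simp
    | succ n ih =>
      intro hn
      have hmem : k0 + n ∈ I := hI.out hk0 hn ⟨by omega, by push_cast; omega⟩
      have h1 := h _ hmem (by rw [add_assoc]; exact_mod_cast hn) (by omega)
      have h2 := ih hmem
      push_cast at h1 ⊢
      rw [← add_assoc]
      linarith
  obtain ⟨N', hN'⟩ := exists_nat_ge (|(k0 : ℝ)| + |(2 * r * k0 + r - c k0) / r|)
  refine ⟨N', fun k hk hk' => ?_⟩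
  have hkr : (N' : ℝ) ≤ k := by exact_mod_cast hk'
  have hkk : k0 ≤ k := by
    have : (k0 : ℝ) ≤ k := by
      linarith [le_abs_self (k0 : ℝ), abs_nonneg ((2 * r * k0 + r - c k0) / r)]
    exact_mod_cast this
  obtain ⟨n, hn⟩ := Int.eq_ofNat_of_zero_le (sub_nonneg.mpr hkk)
  obtain rfl : k = k0 + n := by omega
  have h1 := key n hk
  have h2 : (2 * r * k0 + r - c k0) / r ≤ ((k0 + n : ℤ) : ℝ) := by
    linarith [le_abs_self ((2 * r * k0 + r - c k0) / r), abs_nonneg (k0 : ℝ)]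
  rw [div_le_iff₀ hr] at h2
  push_cast at h2 ⊢
  linarith

lemma separated {N : ℕ} (hN : {k ∈ S.gapIdx | (N : ℤ) ≤ |k|}.PairwiseDisjoint S.disc) {k : ℤ}
    (hk : k ∈ S.gapIdx) (hk' : k + 1 ∈ S.gapIdx) (h : (N : ℤ) ≤ |k|) (h' : (N : ℤ) ≤ |k + 1|) :
    (S.E (2 * k) + S.E (2 * k - 1)) / 2 + 2 * S.R ≤
      (S.E (2 * (k + 1)) + S.E (2 * (k + 1) - 1)) / 2 := by
  have hd := hN ⟨hk, h⟩ ⟨hk', h'⟩ (by omega)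
  have hR := hS.R_pos
  have := (disjoint_ball_ball_iff hR hR).mp hd
  rw [Complex.dist_eq, center, center, ← ofReal_sub, norm_real, Real.norm_eq_abs, abs_sub_comm,
    abs_of_nonneg] at this
  · linarith
  · linarith [hS.right_lt_left hk hk' (by omega), hS.left_lt_right hk, hS.left_lt_right hk']

/-- The `k`-th gap lies at a distance from the origin that grows linearly. -/
theorem linear_growth : ∃ a : ℝ, 0 < a ∧ ∃ N : ℕ, ∀ k ∈ S.gapIdx, (N : ℤ) ≤ |k| →
    ∀ y ∈ S.gap k, a * |(k : ℝ)| ≤ |y| := by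
  obtain ⟨N, hN⟩ := hS.exists_pairwiseDisjoint
  have hR := hS.R_pos
  obtain ⟨N₁, h₁⟩ := linear_growth_of_separated (ordConnected_gapIdx (S := S)) hR
    (c := fun k => (S.E (2 * k) + S.E (2 * k - 1)) / 2) (N := N) fun k hk hk' h =>
      hS.separated hN hk hk' (h.trans (le_abs_self k)) (by have := le_abs_self (k + 1); omega)
  obtain ⟨N₂, h₂⟩ := linear_growth_of_separated (I := {k | -k ∈ S.gapIdx})
    ⟨fun a ha b hb k hk => ordConnected_gapIdx.out hb ha ⟨neg_le_neg hk.2, neg_le_neg hk.1⟩⟩ hR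
    (c := fun k => -((S.E (2 * (-k)) + S.E (2 * (-k) - 1)) / 2)) (N := N) fun k hk hk' h => by
      have e : -(k + 1) + 1 = -k := by ring
      have := hS.separated hN (k := -(k + 1)) hk' (by rw [e]; exact hk)
        (by rw [abs_neg]; have := le_abs_self (k + 1); omega)
        (by rw [e, abs_neg]; exact h.trans (le_abs_self k))
      rw [e] at this
      linarith
  refine ⟨S.R, hR, N₁ + N₂, fun k hk hkN y hy => ?_⟩
  have hl := hS.length_le hk
  have hy1 := hy.1
  have hy2 := hy.2
  have hlt := hS.left_lt_right hk
  push_cast at hkN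
  rcases le_total 0 k with h0 | h0
  · rw [abs_of_nonneg h0] at hkN
    rw [abs_of_nonneg (by exact_mod_cast h0)]
    have := h₁ k hk (by omega)
    linarith [le_abs_self y]
  · rw [abs_of_nonpos h0] at hkN
    rw [abs_of_nonpos (by exact_mod_cast h0)]
    have := h₂ (-k) (by simpa using hk) (by omega)
    rw [neg_neg] at this
    push_cast at this
    linarith [neg_le_abs y]

lemma finite_meeting (T : ℝ) : {k ∈ S.gapIdx | ∃ y ∈ S.gap k, |y| ≤ T}.Finite := by
  obtain ⟨a, ha, N, h⟩ := hS.linear_growth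
  obtain ⟨n, hn⟩ := exists_nat_ge (N + |T| / a)
  refine (finite_Icc (-(n : ℤ)) n).subset ?_
  rintro k ⟨hk, y, hy, hyT⟩
  rw [mem_Icc, ← abs_le]
  by_contra! hlt
  have hlt' : (n : ℝ) < |(k : ℝ)| := by exact_mod_cast hlt
  have hTa : 0 ≤ |T| / a := by positivity
  have hNk : (N : ℝ) ≤ |(k : ℝ)| := by linarith
  have h1 := h k hk (by exact_mod_cast hNk) y hy
  have h2 : |T| / a < |(k : ℝ)| := by linarith [N.cast_nonneg (α := ℝ)]
  rw [div_lt_iff₀ ha] at h2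
  linarith [le_abs_self T]

lemma finite_edges_inter (T : ℝ) : (S.edges ∩ {y | |y| ≤ T}).Finite := by
  refine ((hS.finite_meeting T).biUnion
    (t := fun k => {S.E (2 * k - 1), S.E (2 * k)}) fun k _ => Set.toFinite _).subset ?_
  rintro _ ⟨⟨j, ⟨k, hk, rfl | rfl⟩, rfl⟩, hT⟩
  · exact mem_biUnion (⟨hk, _, hS.left_mem_gap hk, hT⟩ : k ∈ {k ∈ S.gapIdx | _}) (by simp)
  · exact mem_biUnion (⟨hk, _, hS.right_mem_gap hk, hT⟩ : k ∈ {k ∈ S.gapIdx | _}) (by simp)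

lemma eventually_notMem_edges (e : ℝ) : ∀ᶠ y in 𝓝[≠] e, y ∉ S.edges := by
  have hfin := (hS.finite_edges_inter (|e| + 1)).subset (sdiff_subset (t := {e}))
  have h1 : _ ∈ 𝓝[≠] e := mem_nhdsWithin_of_mem_nhds
    (hfin.isClosed.isOpen_compl.mem_nhds (x := e) (by simp))
  filter_upwards [h1, self_mem_nhdsWithin,
    mem_nhdsWithin_of_mem_nhds (Metric.ball_mem_nhds e one_pos)] with y hy1 hy2 hy3 hy
  refine hy1 ⟨⟨hy, ?_⟩, hy2⟩
  rw [Metric.mem_ball, Real.dist_eq] at hy3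
  have := abs_sub_abs_le_abs_sub y e
  simp only [mem_ofPred_eq]
  linarith

lemma isClosed_gaps : IsClosed S.gaps := by
  have : S.gaps = ⋃ k : S.gapIdx, S.gap k := by rw [gaps, biUnion_eq_iUnion]
  rw [this]
  refine LocallyFinite.isClosed_iUnion (fun y => ?_) fun k => isClosed_Icc
  refine ⟨Metric.ball y 1, Metric.ball_mem_nhds y one_pos, ?_⟩
  refine Finite.of_finite_image ((hS.finite_meeting (|y| + 1)).subset ?_)
    (Subtype.val_injective.injOn)
  rintro _ ⟨⟨k, hk⟩, ⟨u, hu, hu'⟩, rfl⟩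
  refine ⟨hk, u, hu, ?_⟩
  rw [Metric.mem_ball, Real.dist_eq] at hu'
  have := abs_sub_abs_le_abs_sub u y
  linarith

lemma isOpen_compl_gaps : IsOpen (((↑) : ℝ → ℂ) '' S.gaps)ᶜ :=
  (Complex.isometry_ofReal.isClosedEmbedding.isClosedMap _ hS.isClosed_gaps).isOpen_compl

lemma notMem_gap_of_mem_bandInterior {n k : ℤ} {y : ℝ} (hy : y ∈ S.bandInterior n)
    (hk : k ∈ S.gapIdx) : y ∉ S.gap k := by
  rintro ⟨h1, h2⟩
  obtain ⟨h, hl, hr⟩ := hy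
  rcases le_or_gt k (n - 1) with hkn | hkn
  · have hn : n - 1 ∈ S.gapIdx := h.elim id fun h => ordConnected_gapIdx.out hk h ⟨hkn, by omega⟩
    have h3 : S.E (2 * k) ≤ S.E (2 * n - 2) := hS.strictMono.monotoneOn (right_mem_edgeIdx hk)
      ⟨n - 1, hn, .inr (by ring)⟩ (by omega)
    linarith [hl hn]
  · have hn : n ∈ S.gapIdx := h.elim (fun h => ordConnected_gapIdx.out h hk ⟨by omega, by omega⟩) id
    have h3 : S.E (2 * n - 1) ≤ S.E (2 * k - 1) := hS.strictMono.monotoneOn (left_mem_edgeIdx hn)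
      (left_mem_edgeIdx hk) (by omega)
    linarith [hr hn]

lemma notMem_gaps_of_mem_bandInterior {n : ℤ} {y : ℝ} (hy : y ∈ S.bandInterior n) :
    y ∉ S.gaps := by
  simp only [gaps, mem_iUnion, not_exists]
  exact fun k hk => hS.notMem_gap_of_mem_bandInterior hy hk

lemma exists_mem_bandInterior {k : ℤ} (hk : k ∈ S.gapIdx) : ∃ y, y ∈ S.bandInterior (k + 1) := by
  have e1 : 2 * (k + 1) - 2 = 2 * k := by ring
  by_cases h : k + 1 ∈ S.gapIdx
  · obtain ⟨y, h1, h2⟩ := exists_between (hS.right_lt_left hk h (by omega))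
    exact ⟨y, .inr h, fun _ => by rwa [e1], fun _ => h2⟩
  · exact ⟨S.E (2 * k) + 1, .inl (by simpa using hk), fun _ => by rw [e1]; linarith,
      fun h' => absurd h' h⟩

lemma exists_notMem_gaps : ∃ y, y ∉ S.gaps := by
  obtain ⟨k, hk⟩ := hS.nonempty
  obtain ⟨y, hy⟩ := hS.exists_mem_bandInterior hk
  exact ⟨y, hS.notMem_gaps_of_mem_bandInterior hy⟩

/-- Every real number is a band edge, or an interior point of a band or of a gap. -/
lemma mem_band_or_gap {y : ℝ} (hy : y ∉ S.edges) :
    (∃ n, y ∈ S.bandInterior n) ∨ ∃ n ∈ S.gapIdx, y ∈ interior (S.gap n) := by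
  obtain ⟨a, ha, N, hN⟩ := hS.linear_growth
  obtain ⟨n, hn⟩ := exists_nat_gt (N + |y| / a)
  have hya : 0 ≤ |y| / a := by positivity
  have hfar : ∀ k ∈ S.gapIdx, (n : ℤ) ≤ |k| → |y| < |S.E (2 * k - 1)| := by
    intro k hk hkn
    have hkn' : (n : ℝ) ≤ |(k : ℝ)| := by exact_mod_cast hkn
    have hNk : (N : ℝ) ≤ |(k : ℝ)| := by linarith
    refine lt_of_lt_of_le ?_ (hN k hk (by exact_mod_cast hNk) _ (hS.left_mem_gap hk))
    rw [mul_comm, ← div_lt_iff₀ ha]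
    linarith [N.cast_nonneg (α := ℝ)]
  have hmono : ∀ k ∈ S.gapIdx, ∀ l ∈ S.gapIdx, k ≤ l → S.E (2 * k - 1) ≤ S.E (2 * l - 1) :=
    fun k hk l hl h => hS.strictMono.monotoneOn (left_mem_edgeIdx hk) (left_mem_edgeIdx hl) (by omega)
  have hfin : ∀ T : ℝ, {k ∈ S.gapIdx | |S.E (2 * k - 1)| ≤ T}.Finite := fun T =>
    (hS.finite_meeting T).subset fun k hk => ⟨hk.1, _, hS.left_mem_gap hk.1, hk.2⟩
  -- Gaps do not accumulate, so there is a last gap starting to the left of `y`; then `y` lies in it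
  -- or in the band that follows. If no gap starts to the left, there is a first gap, and `y` lies
  -- in the band before it.
  by_cases hA : ∃ k ∈ S.gapIdx, S.E (2 * k - 1) < y
  · have hbdd : BddAbove {k ∈ S.gapIdx | S.E (2 * k - 1) < y} := by
      obtain ⟨k0, hk0, hk0y⟩ := hA
      refine ((hfin (|y| + |S.E (2 * k0 - 1)|)).bddAbove.union (bddAbove_Iic (a := k0))).mono ?_
      rintro k ⟨hk, hky⟩
      rcases le_total k k0 with h | h
      · exact .inr h
      · refine .inl ⟨hk, abs_le.mpr ⟨?_, ?_⟩⟩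
        · linarith [hmono _ hk0 _ hk h, neg_abs_le (S.E (2 * k0 - 1)), abs_nonneg y]
        · linarith [le_abs_self y, abs_nonneg (S.E (2 * k0 - 1))]
    obtain ⟨k, ⟨hk, hky⟩, hmax⟩ : ∃ k ∈ {k ∈ S.gapIdx | S.E (2 * k - 1) < y},
        ∀ l ∈ {k ∈ S.gapIdx | S.E (2 * k - 1) < y}, l ≤ k := by
      obtain ⟨b, hb⟩ := hbdd
      obtain ⟨k, hk, hk'⟩ := Int.exists_greatest_of_bdd
        (P := fun k => k ∈ S.gapIdx ∧ S.E (2 * k - 1) < y) ⟨b, fun z hz => hb hz⟩ hA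
      exact ⟨k, hk, hk'⟩
    rcases lt_trichotomy y (S.E (2 * k)) with h | h | h
    · exact .inr ⟨k, hk, by rw [gap, interior_Icc]; exact ⟨hky, h⟩⟩
    · exact absurd ⟨_, right_mem_edgeIdx hk, h.symm⟩ hy
    · refine .inl ⟨k + 1, .inl (by simpa using hk), fun _ => ?_, fun hk1 => ?_⟩
      · rwa [show 2 * (k + 1) - 2 = 2 * k by ring]
      · by_contra! hle
        rcases hle.lt_or_eq with hlt | heq
        · have := hmax (k + 1) ⟨hk1, hlt⟩
          omega
        · exact hy ⟨_, left_mem_edgeIdx hk1, heq⟩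
  · push Not at hA
    have hgt : ∀ k ∈ S.gapIdx, y < S.E (2 * k - 1) := fun k hk =>
      lt_of_le_of_ne (hA k hk) fun h => hy ⟨_, left_mem_edgeIdx hk, h.symm⟩
    obtain ⟨k0, hk0⟩ := hS.nonempty
    have hbdd : BddBelow S.gapIdx := by
      refine ((hfin (|y| + |S.E (2 * k0 - 1)|)).bddBelow.union (bddBelow_Ici (a := k0))).mono ?_
      intro k hk
      rcases le_total k k0 with h | h
      · refine .inl ⟨hk, abs_le.mpr ⟨?_, ?_⟩⟩
        · linarith [hgt k hk, neg_abs_le y, abs_nonneg (S.E (2 * k0 - 1))]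
        · linarith [hmono _ hk _ hk0 h, le_abs_self (S.E (2 * k0 - 1)), abs_nonneg y]
      · exact .inr h
    obtain ⟨b, hb⟩ := hbdd
    obtain ⟨k, hk, hmin⟩ := Int.exists_least_of_bdd (P := fun k => k ∈ S.gapIdx)
      ⟨b, fun z hz => hb hz⟩ ⟨k0, hk0⟩
    refine .inl ⟨k, .inr hk, fun h => ?_, fun _ => hgt k hk⟩
    have := hmin _ h
    omega

omit hS in
lemma center_eq (k : ℤ) : S.center k = (((S.E (2 * k) + S.E (2 * k - 1)) / 2 : ℝ) : ℂ) := rfl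

omit hS in
/-- The complement of the open discs lies in the closure of the domain `domainD`. -/
lemma mem_closure_domainD {w : ℂ} {T : ℝ} (hT : T < ‖w‖) (hw : ∀ k ∈ S.gapIdx, w ∉ S.disc k) :
    w ∈ closure (S.domainD ∩ {z | T < ‖z‖}) := by
  set s : ℝ := if 0 ≤ w.im then 1 else -1 with hs
  -- Moving vertically away from the real axis strictly increases the distance to every real point,
  -- hence to all disc centers and to the origin.
  have hpush : ∀ ε : ℝ, 0 < ε → |w.im| < |w.im + ε * s| := by
    intro ε hε
    by_cases h : 0 ≤ w.im
    · simp only [hs, h, if_true, abs_of_nonneg h]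
      exact lt_of_lt_of_le (by linarith) (le_abs_self _)
    · simp only [hs, h, if_false]
      rw [abs_of_neg (by linarith), ← abs_neg]
      exact lt_of_lt_of_le (by linarith) (le_abs_self _)
  have hdist : ∀ (ε : ℝ) (a : ℝ), 0 < ε → dist w a < dist (w + (ε * s : ℝ) * I) a := by
    intro ε a hε
    rw [dist_eq_re_im, dist_eq_re_im]
    refine Real.sqrt_lt_sqrt (by positivity) ?_
    have := sq_lt_sq.mpr (hpush ε hε)
    simpa using this
  have htend : Tendsto (fun ε : ℝ => w + (ε * s : ℝ) * I) (𝓝[>] 0) (𝓝 w) := by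
    have : Continuous fun ε : ℝ => w + (ε * s : ℝ) * I := by fun_prop
    refine Tendsto.mono_left ?_ inf_le_left
    simpa using this.tendsto 0
  refine mem_closure_of_tendsto htend ?_
  filter_upwards [self_mem_nhdsWithin] with ε hε
  refine ⟨?_, ?_⟩
  · rintro (⟨y, hy⟩ | hmem)
    · have h1 := hpush ε hε
      have h2 := congrArg im hy
      simp only [ofReal_im, add_im, mul_im, ofReal_re, I_im, mul_one, I_re, mul_zero,
        add_zero] at h2
      rw [← h2, abs_zero] at h1
      linarith [abs_nonneg w.im]
    · simp only [mem_iUnion] at hmem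
      obtain ⟨k, hk, hk'⟩ := hmem
      have h1 : S.R ≤ dist w (S.center k) := not_lt.mp (hw k hk)
      have h2 := hdist ε ((S.E (2 * k) + S.E (2 * k - 1)) / 2) hε
      rw [← center_eq] at h2
      exact absurd hk' (by simpa using h1.trans_lt h2)
  · have := hdist ε 0 hε
    simp only [ofReal_zero, dist_zero_right] at this
    exact hT.trans this

/-- Growth of order two on `domainD` implies growth of order two on the plane. -/
theorem growth_of_growth_on_domainD {F : ℂ → ℂ} (hF : Differentiable ℂ F) {c M T : ℝ}
    (hc : 0 ≤ c) (hM : 0 ≤ M)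
    (h : ∀ z ∈ S.domainD, T < ‖z‖ → ‖F z‖ ≤ M * Real.exp (c * ‖z‖ ^ 2)) :
    ∃ c' M' : ℝ, 0 ≤ c' ∧ ∀ z, ‖F z‖ ≤ M' * Real.exp (c' * ‖z‖ ^ 2) := by
  obtain ⟨N, hN⟩ := hS.exists_pairwiseDisjoint
  have hR := hS.R_pos
  obtain ⟨T', hT', hdisc⟩ : ∃ T', T ≤ T' ∧ ∀ k ∈ S.gapIdx, |k| < (N : ℤ) → ∀ w ∈ S.disc k,
      ‖w‖ ≤ T' := by
    have hb : Bornology.IsBounded (⋃ k ∈ Icc (-(N : ℤ)) N, S.disc k) :=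
      (Bornology.isBounded_biUnion (finite_Icc _ _)).mpr fun k _ => Metric.isBounded_ball
    obtain ⟨T', h'⟩ := isBounded_iff_forall_norm_le.mp hb
    refine ⟨max T T', le_max_left _ _, fun k _ hk w hw => (h' w ?_).trans (le_max_right _ _)⟩
    exact mem_biUnion (abs_le.mp hk.le) hw
  have hout : ∀ w : ℂ, T' < ‖w‖ → (∀ k ∈ S.gapIdx, w ∉ S.disc k) →
      ‖F w‖ ≤ M * Real.exp (c * ‖w‖ ^ 2) := by
    intro w hw hw'
    have hcl : IsClosed {z | ‖F z‖ ≤ M * Real.exp (c * ‖z‖ ^ 2)} :=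
      isClosed_le hF.continuous.norm (by fun_prop)
    exact closure_minimal (fun z hz => h z hz.1 hz.2) hcl
      (mem_closure_domainD (hT'.trans_lt hw) hw')
  -- A disc through a point outside this ball keeps its whole boundary circle outside radius `T'`.
  -- There the circle meets no other open disc, so the maximum principle transfers the bound into
  -- the disc.
  obtain ⟨K, hK⟩ := (isCompact_closedBall (0 : ℂ) (T' + 2 * S.R)).exists_bound_of_continuousOn
    hF.continuous.continuousOn
  have hfar : ∀ z : ℂ, T' + 2 * S.R < ‖z‖ →
      ‖F z‖ ≤ M * Real.exp (c * (‖z‖ + 2 * S.R) ^ 2) := by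
    intro z hz
    by_cases hzd : ∀ k ∈ S.gapIdx, z ∉ S.disc k
    · refine (hout z (by linarith) hzd).trans ?_
      gcongr
      linarith
    push Not at hzd
    obtain ⟨k, hk, hzk⟩ := hzd
    have hkN : (N : ℤ) ≤ |k| := by
      by_contra! hlt
      linarith [hdisc k hk hlt z hzk]
    refine norm_le_of_forall_mem_frontier_norm_le Metric.isBounded_ball
      (hF.diffContOnCl (s := S.disc k)) (fun p hp => ?_) (subset_closure hzk)
    have hp1 : dist p (S.center k) = S.R := Metric.frontier_ball_subset_sphere hp
    have hzc : dist z (S.center k) < S.R := hzk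
    have hpz : dist p z ≤ 2 * S.R := by
      linarith [dist_triangle_right p z (S.center k)]
    have hn1 : ‖z‖ ≤ ‖p‖ + 2 * S.R := by
      have := norm_sub_norm_le z p
      rw [dist_comm, dist_eq_norm] at hpz
      linarith
    have hn2 : ‖p‖ ≤ ‖z‖ + 2 * S.R := by
      have := norm_sub_norm_le p z
      rw [dist_eq_norm] at hpz
      linarith
    refine (hout p (by linarith) fun l hl hpl => ?_).trans (by gcongr)
    have hlN : (N : ℤ) ≤ |l| := by
      by_contra! hlt
      linarith [hdisc l hl hlt p hpl]
    by_cases hkl : k = l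
    · subst hkl
      exact absurd hpl (by simp [disc, hp1])
    · have hd := hN ⟨hk, hkN⟩ ⟨hl, hlN⟩ hkl
      have := hd.closure_left Metric.isOpen_ball
      exact this.le_bot ⟨frontier_subset_closure hp, hpl⟩
  -- The constants come from (‖z‖ + 2R)² ≤ 2‖z‖² + 8R².
  refine ⟨2 * c, M * Real.exp (8 * c * S.R ^ 2) + max K 0, by positivity, fun z => ?_⟩
  rw [add_mul]
  rcases le_or_gt ‖z‖ (T' + 2 * S.R) with hz | hz
  · have h1 : ‖F z‖ ≤ K := hK z (by simpa using hz)
    have h2 : 1 ≤ Real.exp (2 * c * ‖z‖ ^ 2) := Real.one_le_exp (by positivity)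
    have h3 : 0 ≤ M * Real.exp (8 * c * S.R ^ 2) * Real.exp (2 * c * ‖z‖ ^ 2) := by positivity
    nlinarith [le_max_left K 0, le_max_right K 0]
  · refine (hfar z hz).trans (le_add_of_le_of_nonneg ?_ (by positivity))
    rw [mul_assoc, ← Real.exp_add]
    gcongr
    nlinarith [sq_nonneg (‖z‖ - 2 * S.R)]

end IsCandidate
end SpectralData
end DiracRHP

/-! ### Boundary limits, and the complement of the gaps -/

namespace DiracRHP

/-- This moves a limit from a half plane to the adjacent bands, which lie on its boundary; it is
used to compare the limits from above and below at a band edge. -/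
lemma tendsto_of_tendsto_of_continuousAt {A B : Set ℂ} {f : ℂ → ℂ} {x l : ℂ} (hx : x ∈ closure A)
    (h : Tendsto f (𝓝[A] x) (𝓝 l)) (hB : ∀ b ∈ B, b ∈ closure A ∧ ContinuousAt f b) :
    Tendsto f (𝓝[B] x) (𝓝 l) := by
  have hc : ContinuousOn (extendFrom A f) (insert x B) := by
    refine continuousOn_extendFrom ?_ ?_
    · rintro b (rfl | hb)
      exacts [hx, (hB b hb).1]
    · rintro b (rfl | hb)
      exacts [⟨l, h⟩, ⟨f b, (hB b hb).2.tendsto.mono_left inf_le_left⟩]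
  have h1 := ((hc x (mem_insert _ _)).mono (subset_insert x B)).tendsto
  rw [extendFrom_eq hx h] at h1
  refine h1.congr' ?_
  filter_upwards [self_mem_nhdsWithin] with b hb
  exact extendFrom_eq (hB b hb).1 ((hB b hb).2.tendsto.mono_left inf_le_left)

lemma tendsto_conj_nhdsWithin_upper (y : ℝ) :
    Tendsto (starRingEnd ℂ) (𝓝[upper] (y : ℂ)) (𝓝[lower] (y : ℂ)) := by
  refine tendsto_nhdsWithin_iff.mpr ⟨?_, ?_⟩
  · refine Tendsto.mono_left ?_ inf_le_left
    simpa using continuous_conj.tendsto (y : ℂ)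
  · filter_upwards [self_mem_nhdsWithin] with z hz
    simpa [lower, upper] using hz

lemma tendsto_conj_nhdsWithin_lower (y : ℝ) :
    Tendsto (starRingEnd ℂ) (𝓝[lower] (y : ℂ)) (𝓝[upper] (y : ℂ)) := by
  refine tendsto_nhdsWithin_iff.mpr ⟨?_, ?_⟩
  · refine Tendsto.mono_left ?_ inf_le_left
    simpa using continuous_conj.tendsto (y : ℂ)
  · filter_upwards [self_mem_nhdsWithin] with z hz
    simpa [lower, upper] using hz

lemma inv_im_pos_iff {z : ℂ} : 0 < (z⁻¹).im ↔ z.im < 0 := by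
  rw [inv_im]
  rcases eq_or_ne z 0 with rfl | hz
  · simp
  · have := normSq_pos.mpr hz
    rw [div_pos_iff_of_pos_right this, neg_pos]

lemma inv_im_neg_iff {z : ℂ} : (z⁻¹).im < 0 ↔ 0 < z.im := by
  rw [← inv_im_pos_iff, inv_inv]

lemma inv_im_ne_zero_iff {z : ℂ} : (z⁻¹).im ≠ 0 ↔ z.im ≠ 0 := by
  rw [ne_iff_lt_or_gt, ne_iff_lt_or_gt, inv_im_neg_iff]
  exact or_comm.trans (or_congr_left inv_im_pos_iff)

lemma tendsto_inv_nhdsWithin_upper {y : ℝ} (hy : y ≠ 0) :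
    Tendsto (fun z : ℂ => z⁻¹) (𝓝[upper] (y : ℂ)) (𝓝[lower] ((y⁻¹ : ℝ) : ℂ)) := by
  refine tendsto_nhdsWithin_iff.mpr ⟨?_, ?_⟩
  · rw [ofReal_inv]
    exact (tendsto_inv₀ (ofReal_ne_zero.mpr hy)).mono_left inf_le_left
  · filter_upwards [self_mem_nhdsWithin] with z hz
    exact inv_im_neg_iff.mpr hz

lemma tendsto_inv_nhdsWithin_lower {y : ℝ} (hy : y ≠ 0) :
    Tendsto (fun z : ℂ => z⁻¹) (𝓝[lower] (y : ℂ)) (𝓝[upper] ((y⁻¹ : ℝ) : ℂ)) := by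
  refine tendsto_nhdsWithin_iff.mpr ⟨?_, ?_⟩
  · rw [ofReal_inv]
    exact (tendsto_inv₀ (ofReal_ne_zero.mpr hy)).mono_left inf_le_left
  · filter_upwards [self_mem_nhdsWithin] with z hz
    exact inv_im_pos_iff.mpr hz

namespace SpectralData

variable {S : SpectralData}

/-- The complement of the gaps. -/
def resolventSet (S : SpectralData) : Set ℂ := (((↑) : ℝ → ℂ) '' S.gaps)ᶜ

lemma ofReal_mem_resolventSet {y : ℝ} : (y : ℂ) ∈ S.resolventSet ↔ y ∉ S.gaps := by
  simp [resolventSet]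

lemma nonreal_subset_resolventSet : nonreal ⊆ S.resolventSet := by
  rintro z hz ⟨y, -, rfl⟩
  exact hz (ofReal_im y)

lemma conj_mem_resolventSet {z : ℂ} (hz : z ∈ S.resolventSet) :
    (starRingEnd ℂ) z ∈ S.resolventSet := by
  rcases real_or_nonreal z with ⟨y, rfl⟩ | h
  · simpa using hz
  · exact nonreal_subset_resolventSet (by simpa [nonreal] using h)

namespace IsCandidate

variable (hS : S.IsCandidate)
include hS

lemma isOpen_resolventSet : IsOpen S.resolventSet := hS.isOpen_compl_gaps

/-- The two half planes are joined through one point of a band, and the remaining points lie in the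
closure of this connected set. -/
lemma isPreconnected_resolventSet : IsPreconnected S.resolventSet := by
  obtain ⟨y, hy⟩ := hS.exists_notMem_gaps
  have hu : IsPreconnected (insert (y : ℂ) upper) := by
    refine (convex_halfSpace_im_gt 0).isPreconnected.subset_closure (subset_insert _ _)
      (insert_subset ?_ subset_closure)
    rw [← upper.eq_1, closure_upper]
    simp
  have hl : IsPreconnected (insert (y : ℂ) lower) := by
    refine (convex_halfSpace_im_lt 0).isPreconnected.subset_closure (subset_insert _ _)
      (insert_subset ?_ subset_closure)
    rw [← lower.eq_1, closure_lower]
    simp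
  refine (hu.union (y : ℂ) (mem_insert _ _) (mem_insert _ _) hl).subset_closure ?_ ?_
  · rintro z ((rfl | hz) | (rfl | hz))
    · exact ofReal_mem_resolventSet.mpr hy
    · exact nonreal_subset_resolventSet (ne_of_gt hz)
    · exact ofReal_mem_resolventSet.mpr hy
    · exact nonreal_subset_resolventSet (ne_of_lt hz)
  · have : nonreal ⊆ insert (y : ℂ) upper ∪ insert (y : ℂ) lower := by
      rw [← upper_union_lower]
      exact union_subset_union (subset_insert _ _) (subset_insert _ _)
    refine Subset.trans (subset_univ _) ?_
    rw [← closure_nonreal]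
    exact closure_mono this

/-- A band edge is a limit of points in the bands. -/
lemma edge_mem_closure_compl_gaps {e : ℝ} (he : e ∈ S.edges) : e ∈ closure S.gapsᶜ := by
  obtain ⟨j, ⟨k, hk, rfl | rfl⟩, rfl⟩ := he
  · refine mem_closure_of_frequently_of_tendsto (f := id) (b := 𝓝[<] S.E (2 * k - 1))
      (Eventually.frequently ?_) (tendsto_id.mono_right inf_le_left)
    have h : ∀ᶠ y in 𝓝[<] S.E (2 * k - 1), k - 1 ∈ S.gapIdx → S.E (2 * k - 2) < y := by
      by_cases h : k - 1 ∈ S.gapIdx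
      · have := hS.right_lt_left h hk (by omega)
        rw [show 2 * (k - 1) = 2 * k - 2 by ring] at this
        filter_upwards [mem_nhdsWithin_of_mem_nhds (Ioi_mem_nhds this)] with y hy _ using hy
      · exact Eventually.of_forall fun y h' => absurd h' h
    filter_upwards [h, self_mem_nhdsWithin] with y hy hy'
    exact hS.notMem_gaps_of_mem_bandInterior (n := k) ⟨.inr hk, hy, fun _ => hy'⟩
  · refine mem_closure_of_frequently_of_tendsto (f := id) (b := 𝓝[>] S.E (2 * k))
      (Eventually.frequently ?_) (tendsto_id.mono_right inf_le_left)
    have h : ∀ᶠ y in 𝓝[>] S.E (2 * k), k + 1 ∈ S.gapIdx → y < S.E (2 * (k + 1) - 1) := by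
      by_cases h : k + 1 ∈ S.gapIdx
      · have := hS.right_lt_left hk h (by omega)
        filter_upwards [mem_nhdsWithin_of_mem_nhds (Iio_mem_nhds this)] with y hy _ using hy
      · exact Eventually.of_forall fun y h' => absurd h' h
    filter_upwards [h, self_mem_nhdsWithin] with y hy hy'
    refine hS.notMem_gaps_of_mem_bandInterior (n := k + 1) ⟨.inl (by simpa using hk),
      fun _ => ?_, hy⟩
    rw [show 2 * (k + 1) - 2 = 2 * k by ring]
    exact hy'

lemma edge_mem_gaps {e : ℝ} (he : e ∈ S.edges) : e ∈ S.gaps := by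
  obtain ⟨j, ⟨k, hk, rfl | rfl⟩, rfl⟩ := he
  · exact gap_subset_gaps hk (hS.left_mem_gap hk)
  · exact gap_subset_gaps hk (hS.right_mem_gap hk)

end IsCandidate

/-! ### Rigidity of symmetric unimodular functions -/

/-- Holomorphic functions on the complement of the gaps with value `1` at infinity and at the band
edges, whose two boundary values on the gaps are unimodular and inverse to each other. -/
structure IsSymmetricUnimodular (S : SpectralData) (g : ℂ → ℂ) : Prop where
  holo : DifferentiableOn ℂ g S.resolventSet
  tendsto : Tendsto g (Bornology.cobounded ℂ ⊓ 𝓟 S.resolventSet) (𝓝 1)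
  boundary : ∀ y ∈ S.gaps, ∃ u v : ℂ, Tendsto g (𝓝[upper] (y : ℂ)) (𝓝 u) ∧
    Tendsto g (𝓝[lower] (y : ℂ)) (𝓝 v) ∧ ‖u‖ = 1 ∧ u * v = 1
  edge : ∀ e ∈ S.edges, Tendsto g (𝓝[nonreal] (e : ℂ)) (𝓝 1)

namespace IsSymmetricUnimodular

variable {g : ℂ → ℂ} (hg : S.IsSymmetricUnimodular g) (hS : S.IsCandidate)
include hg hS

lemma continuousAt {z : ℂ} (hz : z ∈ S.resolventSet) : ContinuousAt g z :=
  (hg.holo.differentiableAt (hS.isOpen_resolventSet.mem_nhds hz)).continuousAt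

omit hS in
lemma exists_forall_norm_sub_one_lt {ε : ℝ} (hε : 0 < ε) :
    ∃ T : ℝ, 0 < T ∧ ∀ z ∈ S.resolventSet, T < ‖z‖ → ‖g z - 1‖ < ε := by
  have h := hg.tendsto.eventually (Metric.ball_mem_nhds 1 hε)
  rw [eventually_inf_principal, ← comap_norm_atTop, eventually_comap] at h
  obtain ⟨T, hT⟩ := eventually_atTop.mp h
  refine ⟨max T 1, by positivity, fun z hz hzT => ?_⟩
  simpa [dist_eq_norm] using hT ‖z‖ ((le_max_left _ _).trans hzT.le) z rfl hz

/-- The modulus extends continuously by 1 across the gaps and tends to 1 at infinity. A value above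
1 would force an interior maximum, hence a constant modulus, contradicting the limit. -/
lemma norm_le_one {z : ℂ} (hz : z ∈ S.resolventSet) : ‖g z‖ ≤ 1 := by
  set G : ℂ → ℝ := extendFrom nonreal fun z => ‖g z‖
  have hlim : ∀ z : ℂ, z ∈ S.resolventSet → Tendsto (fun z => ‖g z‖) (𝓝[nonreal] z) (𝓝 ‖g z‖) :=
    fun z hz => (hg.continuousAt hS hz).norm.tendsto.mono_left inf_le_left
  have hgap : ∀ y ∈ S.gaps, Tendsto (fun z => ‖g z‖) (𝓝[nonreal] (y : ℂ)) (𝓝 1) := by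
    intro y hy
    obtain ⟨u, v, hu, hv, hu1, huv⟩ := hg.boundary y hy
    have hv1 : ‖v‖ = 1 := by simpa [hu1] using congrArg norm huv
    rw [nhdsWithin_nonreal]
    exact (hu1 ▸ hu.norm).sup (hv1 ▸ hv.norm)
  have hGg : ∀ z ∈ S.resolventSet, G z = ‖g z‖ := fun z hz =>
    extendFrom_eq (by simp [closure_nonreal]) (hlim z hz)
  have hG1 : ∀ z ∉ S.resolventSet, G z = 1 := by
    intro z hz
    obtain ⟨y, hy, rfl⟩ := not_not.mp hz
    exact extendFrom_eq (by simp [closure_nonreal]) (hgap y hy)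
  have hGc : Continuous G := by
    rw [← continuousOn_univ]
    refine continuousOn_extendFrom (by simp [closure_nonreal]) fun z _ => ?_
    by_cases hz : z ∈ S.resolventSet
    · exact ⟨_, hlim z hz⟩
    · obtain ⟨y, hy, rfl⟩ := not_not.mp hz
      exact ⟨1, hgap y hy⟩
  by_contra! hlt
  obtain ⟨T, hT0, hT⟩ := hg.exists_forall_norm_sub_one_lt (sub_pos.mpr hlt)
  obtain ⟨z0, hz0⟩ := hGc.exists_forall_ge' z (by
    rw [← Metric.cobounded_eq_cocompact, ← comap_norm_atTop, eventually_comap]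
    filter_upwards [eventually_gt_atTop T] with b hb w hw
    rw [hGg z hz]
    by_cases hwr : w ∈ S.resolventSet
    · rw [hGg w hwr]
      have := hT w hwr (hw ▸ hb)
      have h2 := norm_sub_norm_le (g w) 1
      rw [norm_one] at h2
      linarith
    · rw [hG1 w hwr]
      exact hlt.le)
  have hz0r : z0 ∈ S.resolventSet := by
    by_contra h
    have := hz0 z
    rw [hG1 z0 h, hGg z hz] at this
    linarith
  have hconst := norm_eqOn_of_isPreconnected_of_isMaxOn hS.isPreconnected_resolventSet
    hS.isOpen_resolventSet hg.holo hz0r (fun w hw => by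
      have := hz0 w
      rwa [hGg w hw, hGg z0 hz0r] at this)
  have hw : (((T + 1 : ℝ) : ℂ) * I) ∈ S.resolventSet :=
    nonreal_subset_resolventSet (by simp [nonreal]; positivity)
  have h1 := hT _ hw (by
    rw [norm_mul, norm_I, norm_real, Real.norm_of_nonneg (by positivity)]; linarith)
  have h2 : ‖g (((T + 1 : ℝ) : ℂ) * I)‖ = ‖g z‖ := (hconst hw).trans (hconst hz).symm
  have h3 := norm_sub_norm_le (g (((T + 1 : ℝ) : ℂ) * I)) 1
  rw [norm_one] at h3
  linarith

/-- Infinity is now a removable singularity with value 1, the largest modulus allowed, so the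
maximum principle applies there. -/
lemma eventually_eq_one_of_bounded {T : ℝ} (hT : ∀ y ∈ S.gaps, |y| ≤ T) :
    ∃ T' : ℝ, ∀ z : ℂ, z.im ≠ 0 → T' < ‖z‖ → g z = 1 := by
  have hres : ∀ z : ℂ, T < ‖z‖ → z ∈ S.resolventSet := by
    rintro _ hz ⟨y, hy, rfl⟩
    have := hT y hy
    rw [norm_real, Real.norm_eq_abs] at hz
    linarith
  have hsmall : ∀ᶠ ζ : ℂ in 𝓝[≠] 0, ζ⁻¹ ∈ S.resolventSet := by
    have h := (tendsto_inv₀_nhdsNE_zero (α := ℂ)).eventually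
      (tendsto_norm_cobounded_atTop.eventually (eventually_gt_atTop T))
    filter_upwards [h] with ζ hζ using hres _ hζ
  set G : ℂ → ℂ := Function.update (fun ζ => g ζ⁻¹) 0 1
  have hG : ∀ ζ ≠ 0, G ζ = g ζ⁻¹ := fun ζ hζ => Function.update_of_ne hζ _ _
  have hG0 : G 0 = 1 := Function.update_self _ _ _
  have hcont : ContinuousAt G 0 := by
    rw [continuousAt_update_same]
    exact hg.tendsto.comp (tendsto_inf.mpr ⟨tendsto_inv₀_nhdsNE_zero, tendsto_principal.mpr hsmall⟩)
  have hdiff : ∀ᶠ ζ in 𝓝[≠] (0 : ℂ), DifferentiableAt ℂ G ζ := by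
    filter_upwards [hsmall, self_mem_nhdsWithin] with ζ h1 h2
    have h3 : DifferentiableAt ℂ (fun ζ => g ζ⁻¹) ζ :=
      (hg.holo.differentiableAt (hS.isOpen_resolventSet.mem_nhds h1)).comp ζ
        (differentiableAt_inv h2)
    exact h3.congr_of_eventuallyEq (by
      filter_upwards [isOpen_ne.mem_nhds h2] with w hw using hG w hw)
  have han := analyticAt_of_differentiable_on_punctured_nhds_of_continuousAt hdiff hcont
  have hmax : IsLocalMax (norm ∘ G) 0 := by
    rw [IsLocalMax, IsMaxFilter, ← nhdsNE_sup_pure, eventually_sup]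
    refine ⟨?_, by simp⟩
    filter_upwards [hsmall, self_mem_nhdsWithin] with ζ h1 h2
    simpa [hG0, hG ζ h2] using hg.norm_le_one hS h1
  have hev := eventually_eq_of_isLocalMax_norm
    (han.eventually_analyticAt.mono fun _ h => h.differentiableAt) hmax
  obtain ⟨δ, hδ, hball⟩ := Metric.eventually_nhds_iff_ball.mp hev
  refine ⟨δ⁻¹, fun z hz hzδ => ?_⟩
  have hz0 : z ≠ 0 := by rintro rfl; simp at hz
  have := hball z⁻¹ (by simpa using inv_lt_of_inv_lt₀ hδ hzδ)
  rwa [hG0, hG _ (inv_ne_zero hz0), inv_inv] at this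

/-- Infinity is not isolated from the gaps here. Inverse boundary values cancel in g + 1/g, which is
therefore analytic at infinity; it equals 2 at edges tending to infinity, so it is identically 2
nearby and (g - 1)² = 0. -/
lemma eventually_eq_one_of_unbounded (hT : ∀ T : ℝ, ∃ y ∈ S.gaps, T < |y|) :
    ∃ T' : ℝ, ∀ z : ℂ, z.im ≠ 0 → T' < ‖z‖ → g z = 1 := by
  obtain ⟨T, hT0, hgT⟩ := hg.exists_forall_norm_sub_one_lt one_pos
  have hne : ∀ z ∈ S.resolventSet, T < ‖z‖ → g z ≠ 0 := by
    intro z hz hzT h0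
    have := hgT z hz hzT
    simp [h0] at this
  set K : ℂ → ℂ := fun ζ => g ζ⁻¹ + (g ζ⁻¹)⁻¹ with hK
  set U : Set ℂ := Metric.ball 0 T⁻¹
  have hU : ∀ ζ ∈ U, ζ ≠ 0 → T < ‖ζ⁻¹‖ := by
    intro ζ hζ h0
    rw [norm_inv]
    exact (lt_inv_comm₀ hT0 (norm_pos_iff.mpr h0)).mpr (by simpa [U] using hζ)
  have hd : ∀ ζ ∈ U, ζ⁻¹ ∈ S.resolventSet → ζ ≠ 0 → DifferentiableAt ℂ K ζ := by
    intro ζ hζ hr h0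
    have h1 : DifferentiableAt ℂ (fun ζ => g ζ⁻¹) ζ :=
      (hg.holo.differentiableAt (hS.isOpen_resolventSet.mem_nhds hr)).comp ζ
        (differentiableAt_inv h0)
    exact h1.add (h1.inv (hne _ hr (hU ζ hζ h0)))
  have hlim0 : Tendsto K (𝓝[nonreal] 0) (𝓝 2) := by
    have h1 : Tendsto (fun ζ => g ζ⁻¹) (𝓝[nonreal] 0) (𝓝 1) := by
      refine hg.tendsto.comp (tendsto_inf.mpr ⟨tendsto_inv₀_nhdsNE_zero.mono_left
        (nhdsWithin_mono _ fun z hz => ?_), tendsto_principal.mpr ?_⟩)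
      · rintro rfl
        simp [nonreal] at hz
      · filter_upwards [self_mem_nhdsWithin] with z hz
        exact nonreal_subset_resolventSet (inv_im_ne_zero_iff.mpr hz)
    have := h1.add (h1.inv₀ one_ne_zero)
    norm_num at this
    exact this
  have hlime : ∀ e ∈ S.edges, e ≠ 0 → Tendsto K (𝓝[nonreal] ((e⁻¹ : ℝ) : ℂ)) (𝓝 2) := by
    intro e he h0
    have h1 : Tendsto (fun ζ => g ζ⁻¹) (𝓝[nonreal] ((e⁻¹ : ℝ) : ℂ)) (𝓝 1) := by
      refine (hg.edge e he).comp ?_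
      have hu := tendsto_inv_nhdsWithin_upper (inv_ne_zero h0)
      have hl := tendsto_inv_nhdsWithin_lower (inv_ne_zero h0)
      rw [inv_inv] at hu hl
      rw [nhdsWithin_nonreal, nhdsWithin_nonreal]
      exact (hu.mono_right le_sup_right).sup (hl.mono_right le_sup_left)
    have := h1.add (h1.inv₀ one_ne_zero)
    rw [inv_one, one_add_one_eq_two] at this
    exact this
  have hdiff : DifferentiableOn ℂ (extendFrom nonreal K) U := by
    refine differentiableOn_extendFrom_nonreal Metric.isOpen_ball (fun ζ hζ h => hd ζ hζ
      (nonreal_subset_resolventSet (inv_im_ne_zero_iff.mpr h)) ?_) fun y hy => ?_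
    · rintro rfl
      simp at h
    · rcases eq_or_ne y 0 with rfl | hy0
      · exact ⟨2, by simpa using hlim0⟩
      by_cases hyg : y⁻¹ ∈ S.gaps
      · obtain ⟨u, v, hu, hv, hu1, huv⟩ := hg.boundary _ hyg
        have hu0 : u ≠ 0 := left_ne_zero_of_mul_eq_one huv
        have hv' : v = u⁻¹ := (eq_inv_of_mul_eq_one_right huv)
        refine ⟨u + u⁻¹, ?_⟩
        rw [nhdsWithin_nonreal]
        refine Tendsto.sup ?_ ?_
        · have h1 := hv.comp (tendsto_inv_nhdsWithin_upper hy0)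
          have := h1.add (h1.inv₀ (hv' ▸ inv_ne_zero hu0))
          rwa [hv', inv_inv, add_comm u⁻¹] at this
        · have h1 := hu.comp (tendsto_inv_nhdsWithin_lower hy0)
          exact h1.add (h1.inv₀ hu0)
      · refine ⟨_, ((hd y hy ?_ (ofReal_ne_zero.mpr hy0)).continuousAt.tendsto).mono_left
          inf_le_left⟩
        rw [← ofReal_inv]
        exact ofReal_mem_resolventSet.mpr hyg
  have h0U : U ∈ 𝓝 (0 : ℂ) := Metric.ball_mem_nhds _ (by positivity)
  have han := hdiff.analyticAt h0U
  have hfreq : ∃ᶠ ζ in 𝓝[≠] (0 : ℂ), extendFrom nonreal K ζ = 2 := by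
    rw [frequently_iff]
    intro V hV
    obtain ⟨δ, hδ, hball⟩ := Metric.mem_nhdsWithin_iff.mp hV
    -- The margin `S.R` covers the step from `y` to the right edge of its gap.
    obtain ⟨y, hy, hyT⟩ := hT (δ⁻¹ + S.R)
    simp only [gaps, mem_iUnion] at hy
    obtain ⟨k, hk, hyk⟩ := hy
    have hR := hS.length_le hk
    have hδ' : 0 < δ⁻¹ := by positivity
    have he : δ⁻¹ < |S.E (2 * k)| := by
      have h1 : |y - S.E (2 * k)| ≤ S.R := abs_le.mpr ⟨by linarith [hyk.1], by linarith [hyk.2, hS.R_pos]⟩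
      have := abs_sub_abs_le_abs_sub y (S.E (2 * k))
      linarith
    have he0 : S.E (2 * k) ≠ 0 := by
      intro h
      rw [h, abs_zero] at he
      linarith
    refine ⟨((S.E (2 * k))⁻¹ : ℝ), hball ⟨?_, ?_⟩, extendFrom_eq (by simp [closure_nonreal])
      (hlime _ ⟨_, right_mem_edgeIdx hk, rfl⟩ he0)⟩
    · rw [mem_ball_zero_iff, norm_real, norm_inv, Real.norm_eq_abs]
      exact inv_lt_of_inv_lt₀ hδ he
    · simpa using he0
  have hev := (han.frequently_eq_iff_eventually_eq analyticAt_const).mp hfreq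
  obtain ⟨δ, hδ, hball⟩ := Metric.eventually_nhds_iff_ball.mp (hev.and h0U)
  refine ⟨δ⁻¹, fun z hz hzδ => ?_⟩
  have hz0 : z ≠ 0 := by rintro rfl; simp at hz
  have hzi : (z⁻¹).im ≠ 0 := inv_im_ne_zero_iff.mpr hz
  obtain ⟨h1, h2⟩ := hball z⁻¹ (by simpa using inv_lt_of_inv_lt₀ hδ hzδ)
  rw [extendFrom_nonreal_eq (U := U) (fun ζ hζ h => hd ζ hζ
    (nonreal_subset_resolventSet (inv_im_ne_zero_iff.mpr h)) (by rintro rfl; simp at h)) h2 hzi] at h1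
  simp only [hK, inv_inv] at h1
  have hgz := hne z (nonreal_subset_resolventSet hz) (by
    simpa using hU _ h2 (inv_ne_zero hz0))
  field_simp at h1
  have h3 : (g z - 1) ^ 2 = 0 := by linear_combination h1
  exact sub_eq_zero.mp (pow_eq_zero_iff two_ne_zero |>.mp h3)

theorem eq_one {z : ℂ} (hz : z ∈ S.resolventSet) : g z = 1 := by
  obtain ⟨T, hT⟩ : ∃ T' : ℝ, ∀ z : ℂ, z.im ≠ 0 → T' < ‖z‖ → g z = 1 := by
    by_cases h : ∃ T, ∀ y ∈ S.gaps, |y| ≤ T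
    · obtain ⟨T, hT⟩ := h
      exact hg.eventually_eq_one_of_bounded hS hT
    · push Not at h
      exact hg.eventually_eq_one_of_unbounded hS h
  set w : ℂ := ((|T| + 1 : ℝ) : ℂ) * I with hw
  have hwi : w.im ≠ 0 := by
    rw [hw, im_ofReal_mul, I_im]
    positivity
  have hwn : T < ‖w‖ := by
    rw [hw, norm_mul, norm_I, norm_real, Real.norm_of_nonneg (by positivity)]
    linarith [le_abs_self T]
  have han : AnalyticOnNhd ℂ g S.resolventSet := hg.holo.analyticOnNhd hS.isOpen_resolventSet
  refine han.eqOn_of_preconnected_of_eventuallyEq analyticOnNhd_const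
    hS.isPreconnected_resolventSet (nonreal_subset_resolventSet hwi) ?_ hz
  filter_upwards [nonreal_mem_nhds hwi, continuous_norm.continuousAt.eventually
    (Ioi_mem_nhds hwn)] with v hv hv' using hT v hv hv'

end IsSymmetricUnimodular

/-! ### The scalar problem: no zeros, and decay of the gap lengths -/

namespace SolvesScalarRHP

variable {L : ℝ} {r : ℂ → ℂ} (hr : S.SolvesScalarRHP L r) (hS : S.IsCandidate)
include hr hS

lemma continuousAt {z : ℂ} (hz : z ∈ S.resolventSet) : ContinuousAt r z :=
  (hr.holo.differentiableAt (hS.isOpen_resolventSet.mem_nhds hz)).continuousAt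

lemma boundary_eq_of_mem_edges {e : ℝ} (he : e ∈ S.edges) {u v : ℂ}
    (hu : Tendsto r (𝓝[upper] (e : ℂ)) (𝓝 u)) (hv : Tendsto r (𝓝[lower] (e : ℂ)) (𝓝 v)) : u = v := by
  set A : Set ℂ := ((↑) : ℝ → ℂ) '' S.gapsᶜ
  have hne : (𝓝[A] (e : ℂ)).NeBot := by
    rw [← mem_closure_iff_nhdsWithin_neBot]
    exact image_closure_subset_closure_image continuous_ofReal
      (mem_image_of_mem _ (hS.edge_mem_closure_compl_gaps he))
  have hA : ∀ b ∈ A, b ∈ S.resolventSet ∧ b.im = 0 := by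
    rintro _ ⟨y, hy, rfl⟩
    exact ⟨ofReal_mem_resolventSet.mpr hy, ofReal_im y⟩
  exact tendsto_nhds_unique
    (tendsto_of_tendsto_of_continuousAt (by simp [closure_upper]) hu fun b hb =>
      ⟨by simp [closure_upper, (hA b hb).2], hr.continuousAt hS (hA b hb).1⟩)
    (tendsto_of_tendsto_of_continuousAt (by simp [closure_lower]) hv fun b hb =>
      ⟨by simp [closure_lower, (hA b hb).2], hr.continuousAt hS (hA b hb).1⟩)

omit hS in
lemma exists_boundary {y : ℝ} (hy : y ∈ S.gaps) : ∃ u v : ℂ,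
    Tendsto r (𝓝[upper] (y : ℂ)) (𝓝 u) ∧ Tendsto r (𝓝[lower] (y : ℂ)) (𝓝 v) ∧ u * v = 1 := by
  obtain ⟨rp, rm, -, -, h1, h2⟩ := hr.boundary
  exact ⟨rp y, rm y, (h1 y hy).1, (h1 y hy).2, h2 y hy⟩

omit hS in
lemma exists_bound : ∃ C T : ℝ, 0 < C ∧ 0 < T ∧ ∀ z ∈ S.resolventSet, T < ‖z‖ →
    ‖r z * exp (-(I * z * L)) - 1‖ ≤ C / ‖z‖ := by
  obtain ⟨C, hC, h⟩ := hr.asymp.exists_pos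
  have h := h.bound
  rw [eventually_inf_principal, ← comap_norm_atTop, eventually_comap] at h
  obtain ⟨T, hT⟩ := eventually_atTop.mp h
  refine ⟨C, max T 1, hC, by positivity, fun z hz hzT => ?_⟩
  simpa [div_eq_mul_inv] using hT ‖z‖ ((le_max_left _ _).trans hzT.le) z rfl hz

omit hS in
lemma tendsto_one : Tendsto (fun z => r z * exp (-(I * z * L)))
    (Bornology.cobounded ℂ ⊓ 𝓟 S.resolventSet) (𝓝 1) := by
  have h : Tendsto (fun z : ℂ => z⁻¹) (Bornology.cobounded ℂ ⊓ 𝓟 S.resolventSet) (𝓝 0) :=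
    tendsto_inv₀_cobounded.mono_left inf_le_left
  exact tendsto_sub_nhds_zero_iff.mp (hr.asymp.trans_tendsto h)

/-- Conjugation swaps the two sides, so the boundary values are u·conj v and v·conj u, unimodular
because uv = 1. At an edge u = v, hence |u| = 1 and both values are 1. -/
lemma isSymmetricUnimodular :
    S.IsSymmetricUnimodular fun z => r z * (starRingEnd ℂ) (r ((starRingEnd ℂ) z)) where
  holo := by
    intro z hz
    have h1 := hr.holo.differentiableAt (hS.isOpen_resolventSet.mem_nhds hz)
    have h2 := hr.holo.differentiableAt (hS.isOpen_resolventSet.mem_nhds (conj_mem_resolventSet hz))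
    have h3 : DifferentiableAt ℂ (fun z => (starRingEnd ℂ) (r ((starRingEnd ℂ) z))) z := by
      have := h2.conj_conj
      simpa [Function.comp_def] using this
    exact (h1.mul h3).differentiableWithinAt
  tendsto := by
    have h1 := hr.tendsto_one
    have hc : Tendsto (starRingEnd ℂ) (Bornology.cobounded ℂ ⊓ 𝓟 S.resolventSet)
        (Bornology.cobounded ℂ ⊓ 𝓟 S.resolventSet) := by
      refine tendsto_inf.mpr ⟨?_, tendsto_principal.mpr ?_⟩
      · rw [← tendsto_norm_atTop_iff_cobounded]
        simpa using tendsto_norm_cobounded_atTop.mono_left inf_le_left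
      · filter_upwards [mem_inf_of_right (mem_principal_self _)] with z hz
        exact conj_mem_resolventSet hz
    have h2 := (continuous_conj.tendsto 1).comp (h1.comp hc)
    have := h1.mul h2
    rw [map_one, one_mul] at this
    refine this.congr fun z => ?_
    simp only [Function.comp_apply, map_mul, ← exp_conj, map_neg, conj_I, conj_conj, conj_ofReal]
    have : exp (-(I * z * L)) * exp (-(-I * z * L)) = 1 := by
      rw [← exp_add, neg_mul, neg_mul, neg_neg, neg_add_cancel, exp_zero]
    linear_combination (r z * (starRingEnd ℂ) (r ((starRingEnd ℂ) z))) * this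
  boundary := by
    intro y hy
    obtain ⟨u, v, hu, hv, huv⟩ := hr.exists_boundary hy
    have hu' := (continuous_conj.tendsto u).comp (hu.comp (tendsto_conj_nhdsWithin_lower y))
    have hv' := (continuous_conj.tendsto v).comp (hv.comp (tendsto_conj_nhdsWithin_upper y))
    refine ⟨_, _, hu.mul hv', hv.mul hu', ?_, ?_⟩
    · rw [norm_mul, RCLike.norm_conj, ← norm_mul, huv, norm_one]
    · have := congrArg (starRingEnd ℂ) huv
      rw [map_mul, map_one] at this
      linear_combination ((starRingEnd ℂ) u * (starRingEnd ℂ) v) * huv + this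
  edge := by
    intro e he
    obtain ⟨u, v, hu, hv, huv⟩ := hr.exists_boundary (hS.edge_mem_gaps he)
    obtain rfl := hr.boundary_eq_of_mem_edges hS he hu hv
    have hu' := (continuous_conj.tendsto u).comp (hu.comp (tendsto_conj_nhdsWithin_lower e))
    have hv' := (continuous_conj.tendsto u).comp (hv.comp (tendsto_conj_nhdsWithin_upper e))
    have h1 : u * (starRingEnd ℂ) u = 1 := by
      have := congrArg norm huv
      rw [norm_mul, norm_one] at this
      rw [mul_conj, normSq_eq_norm_sq, sq, this, ofReal_one]
    rw [nhdsWithin_nonreal, ← h1]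
    exact (hu.mul hv').sup (hv.mul hu')

/-- The solution of the scalar Riemann-Hilbert problem has no zeros. -/
theorem ne_zero {z : ℂ} (hz : z ∈ S.resolventSet) : r z ≠ 0 := fun h => by
  have := (hr.isSymmetricUnimodular hS).eq_one hS hz
  simp [h] at this

omit hr hS in
lemma norm_boundary_sub_one_le {C T : ℝ} (h : ∀ z ∈ S.resolventSet, T < ‖z‖ →
    ‖r z * exp (-(I * z * L)) - 1‖ ≤ C / ‖z‖) {y : ℝ} (hy : T < |y|) (hy0 : y ≠ 0) {A : Set ℂ}
    (hA : A ⊆ nonreal) [(𝓝[A] (y : ℂ)).NeBot] {u : ℂ} (hu : Tendsto r (𝓝[A] (y : ℂ)) (𝓝 u)) :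
    ‖u * exp (-(I * y * L)) - 1‖ ≤ C / |y| := by
  have hexp : Continuous fun z : ℂ => exp (-(I * z * L)) := by fun_prop
  have h1 := ((hu.mul ((hexp.tendsto (y : ℂ)).mono_left inf_le_left)).sub_const 1).norm
  have hn : Tendsto (fun z : ℂ => ‖z‖) (𝓝[A] (y : ℂ)) (𝓝 |y|) := by
    refine Tendsto.mono_left ?_ inf_le_left
    simpa using (continuous_norm (E := ℂ)).tendsto (y : ℂ)
  refine le_of_tendsto_of_tendsto h1 ((tendsto_const_nhds (x := C)).div hn (abs_ne_zero.mpr hy0)) ?_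
  filter_upwards [hn.eventually (Ioi_mem_nhds hy), self_mem_nhdsWithin] with z hz hzA
  exact h z (nonreal_subset_resolventSet (hA hzA)) hz

/-- Both boundary values of r e^{-izL} are 1 + O(1/|y|), and their product is e^{-2iyL} because
those of r are mutually inverse. -/
lemma exists_norm_exp_sub_one_le : ∃ C : ℝ, 0 < C ∧ ∃ N : ℕ, ∀ k ∈ S.gapIdx, (N : ℤ) ≤ |k| →
    ∀ y ∈ S.gap k, ‖exp (-(2 * I * y * L)) - 1‖ ≤ C / |(k : ℝ)| := by
  obtain ⟨a, ha, N, hN⟩ := hS.linear_growth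
  obtain ⟨C, T, hC, hT, h⟩ := hr.exists_bound
  obtain ⟨n, hn⟩ := exists_nat_gt (N + (T + C) / a)
  have hTC : 0 < (T + C) / a := by positivity
  refine ⟨3 * (C / a), by positivity, n, fun k hk hkn y hy => ?_⟩
  have hkn' : (n : ℝ) ≤ |(k : ℝ)| := by exact_mod_cast hkn
  have hNk : (N : ℝ) ≤ |(k : ℝ)| := by linarith
  have hky := hN k hk (by exact_mod_cast hNk) y hy
  have hk1 : (T + C) / a < |(k : ℝ)| := by linarith [N.cast_nonneg (α := ℝ)]
  have hkpos : 0 < |(k : ℝ)| := by linarith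
  rw [div_lt_iff₀ ha] at hk1
  have hyT : T < |y| := by linarith
  have hyC : C ≤ |y| := by linarith
  have hy0 : y ≠ 0 := by
    rintro rfl
    simp at hyT
    linarith
  obtain ⟨u, v, hu, hv, huv⟩ := hr.exists_boundary (gap_subset_gaps hk hy)
  have hu1 := norm_boundary_sub_one_le h hyT hy0 (A := upper) (fun z hz => ne_of_gt hz) hu
  have hv1 := norm_boundary_sub_one_le h hyT hy0 (A := lower) (fun z hz => ne_of_lt hz) hv
  set p := u * exp (-(I * y * L))
  set q := v * exp (-(I * y * L))
  have hpq : exp (-(2 * I * y * L)) = p * q := by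
    have : exp (-(2 * I * y * L)) = exp (-(I * y * L)) * exp (-(I * y * L)) := by
      rw [← exp_add]; ring_nf
    rw [this]
    linear_combination (-(exp (-(I * y * L)) * exp (-(I * y * L)))) * huv
  have hC1 : C / |y| ≤ 1 := div_le_one_of_le₀ hyC (abs_nonneg y)
  have hq : ‖q‖ ≤ 2 := by
    have := norm_sub_norm_le q 1
    rw [norm_one] at this
    linarith
  calc ‖exp (-(2 * I * y * L)) - 1‖ = ‖(p - 1) * q + (q - 1)‖ := by rw [hpq]; ring_nf
    _ ≤ ‖p - 1‖ * ‖q‖ + ‖q - 1‖ := (norm_add_le _ _).trans (by rw [norm_mul])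
    _ ≤ C / |y| * 2 + C / |y| := by gcongr
    _ = 3 * (C / |y|) := by ring
    _ ≤ 3 * (C / (a * |(k : ℝ)|)) := by gcongr
    _ = 3 * (C / a) / |(k : ℝ)| := by rw [← div_div]; ring

/-- The gap lengths decay. -/
theorem exists_length_le (hL : 0 < L) : ∃ C : ℝ, 0 < C ∧ ∃ N : ℕ, ∀ k ∈ S.gapIdx, (N : ℤ) ≤ |k| →
    S.E (2 * k) - S.E (2 * k - 1) ≤ C / |(k : ℝ)| := by
  obtain ⟨C, hC, N, h⟩ := hr.exists_norm_exp_sub_one_le hS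
  -- Beyond this index C/|k| < 1, so |sin(Ls)| stays below 1 along the whole gap. Hence Ll cannot
  -- pass π/2, and Jordan's inequality bounds `l` by the sine.
  obtain ⟨n, hn⟩ := exists_nat_gt (N + C)
  have hpi := Real.pi_pos
  refine ⟨C * (Real.pi / (2 * L)), by positivity, n, fun k hk hkn => ?_⟩
  have hkn' : (n : ℝ) ≤ |(k : ℝ)| := by exact_mod_cast hkn
  have hNk : (N : ℝ) ≤ |(k : ℝ)| := by linarith
  have hkC : C < |(k : ℝ)| := by linarith [N.cast_nonneg (α := ℝ)]
  have hkpos : 0 < |(k : ℝ)| := by linarith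
  set l := S.E (2 * k) - S.E (2 * k - 1) with hl
  have hl0 : 0 < l := sub_pos.mpr (hS.left_lt_right hk)
  have hsin : ∀ s ∈ Icc 0 l, |Real.sin (L * s)| ≤ C / |(k : ℝ)| := by
    intro s hs
    set y := S.E (2 * k - 1) + s
    have h1 := h k hk (by exact_mod_cast hNk) _ (hS.left_mem_gap hk)
    have h2 := h k hk (by exact_mod_cast hNk) y ⟨by linarith [hs.1], by linarith [hs.2]⟩
    have h3 : ‖exp (-(2 * I * y * L)) - exp (-(2 * I * (S.E (2 * k - 1) : ℝ) * L))‖ =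
        2 * |Real.sin (L * s)| := by
      have e1 : exp (-(2 * I * y * L)) - exp (-(2 * I * (S.E (2 * k - 1) : ℝ) * L)) =
          exp (((-(2 * S.E (2 * k - 1) * L) : ℝ) : ℂ) * I) *
            (exp (I * ((-(2 * s * L) : ℝ) : ℂ)) - 1) := by
        rw [mul_sub, ← exp_add, mul_one]
        congr 2
        · simp only [y]
          push_cast
          ring
        · push_cast
          ring
      rw [e1, norm_mul, norm_exp_ofReal_mul_I, one_mul, norm_exp_I_mul_ofReal_sub_one, norm_mul,
        Real.norm_eq_abs, Real.norm_eq_abs, abs_two, show -(2 * s * L) / 2 = -(L * s) by ring,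
        Real.sin_neg, abs_neg]
    have h4 := norm_sub_le (exp (-(2 * I * y * L)) - 1) (exp (-(2 * I * (S.E (2 * k - 1) : ℝ) * L)) - 1)
    rw [sub_sub_sub_cancel_right, h3] at h4
    linarith
  have hCk : C / |(k : ℝ)| < 1 := (div_lt_one hkpos).mpr hkC
  have hLl : L * l ≤ Real.pi / 2 := by
    by_contra! hlt
    have := hsin (Real.pi / 2 / L) ⟨by positivity, by rw [div_le_iff₀ hL]; linarith⟩
    rw [mul_div_cancel₀ _ hL.ne', Real.sin_pi_div_two, abs_one] at this
    linarith
  have h1 := Real.mul_le_sin (by positivity : 0 ≤ L * l) hLl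
  have h2 := (le_abs_self _).trans (hsin l ⟨hl0.le, le_rfl⟩)
  have h3 : l = 2 / Real.pi * (L * l) * (Real.pi / (2 * L)) := by field_simp
  calc l = 2 / Real.pi * (L * l) * (Real.pi / (2 * L)) := h3
    _ ≤ C / |(k : ℝ)| * (Real.pi / (2 * L)) := by gcongr; exact h1.trans h2
    _ = C * (Real.pi / (2 * L)) / |(k : ℝ)| := by ring

end SolvesScalarRHP

end SpectralData
end DiracRHP

/-! ### Infinite products and the size of det B in the sectors -/

namespace DiracRHP

lemma summable_of_norm_le_div_sq {E : Type*} [NormedAddCommGroup E] [CompleteSpace E] {f : ℤ → E}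
    {D : ℝ} {N : ℕ} (h : ∀ k : ℤ, (N : ℤ) ≤ |k| → ‖f k‖ ≤ D / (k : ℝ) ^ 2) : Summable f := by
  have hs : Summable fun k : ℤ => D / (k : ℝ) ^ 2 := by
    simpa [div_eq_mul_inv] using (Real.summable_one_div_int_pow.mpr one_lt_two).mul_left D
  refine hs.of_norm_bounded_eventually ?_
  refine (finite_Icc (-(N : ℤ)) N).subset fun k hk => ?_
  rw [mem_Icc, ← abs_le]
  by_contra! hlt
  exact hk (h k hlt.le)

namespace SpectralData

/-- The scale `|a|` in the factor of `a`, `1` for `a = 0`. -/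
def factorScale (a : ℝ) : ℝ := open Classical in if a = 0 then 1 else |a|

lemma factorScale_pos (a : ℝ) : 0 < factorScale a := by
  rw [factorScale]
  split_ifs with h
  · exact one_pos
  · exact abs_pos.mpr h

lemma factorScale_of_ne_zero {a : ℝ} (ha : a ≠ 0) : factorScale a = |a| := if_neg ha

/-- The formula also covers `a = 0`: division by zero gives 0, so the exponential becomes 1. -/
lemma norm_factor (a : ℝ) (z : ℂ) :
    ‖factor a z‖ = ‖z - a‖ / factorScale a * Real.exp (z.re / a) := by
  rw [factor, factorScale]
  split_ifs with h
  · simp [h]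
  · have ha : (a : ℂ) ≠ 0 := ofReal_ne_zero.mpr h
    rw [norm_mul, norm_exp, div_ofReal_re, one_sub_div ha, norm_div, norm_real, Real.norm_eq_abs,
      norm_sub_rev]

lemma factor_ne_zero {a : ℝ} {z : ℂ} (h : z ≠ a) : factor a z ≠ 0 := by
  rw [← norm_pos_iff, norm_factor]
  have := factorScale_pos a
  have := norm_pos_iff.mpr (sub_ne_zero.mpr h)
  positivity

lemma factorRoot_pow {n : ℕ} (hn : n ≠ 0) (a : ℝ) (z : ℂ) :
    factorRoot n a z ^ n = factor a z := by
  have hn' : (n : ℂ) ≠ 0 := Nat.cast_ne_zero.mpr hn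
  rw [factorRoot, factor]
  split_ifs with h
  · rw [one_div, cpow_nat_inv_pow _ hn]
  · have ha : (a : ℂ) ≠ 0 := ofReal_ne_zero.mpr h
    rw [mul_pow, one_div, cpow_nat_inv_pow _ hn, ← exp_nat_mul]
    congr 2
    field_simp

lemma norm_factorRoot_pow {n : ℕ} (hn : n ≠ 0) (a : ℝ) (z : ℂ) :
    ‖factorRoot n a z‖ ^ n = ‖factor a z‖ := by
  rw [← norm_pow, factorRoot_pow hn]

lemma norm_factor_sub_one_le {a : ℝ} {z : ℂ} (ha : a ≠ 0) (h : 2 * ‖z‖ ≤ |a|) :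
    ‖factor a z - 1‖ ≤ 3 * ‖z‖ ^ 2 / a ^ 2 := by
  have hu : ‖z / a‖ ≤ 1 / 2 := by
    rw [norm_div, norm_real, Real.norm_eq_abs, div_le_iff₀ (abs_pos.mpr ha)]
    linarith
  have hu2 : ‖z / a‖ ^ 2 = ‖z‖ ^ 2 / a ^ 2 := by
    rw [norm_div, norm_real, Real.norm_eq_abs, div_pow, sq_abs]
  rw [factor, if_neg ha, mul_div_assoc, ← hu2]
  set u := z / a
  have h1 := norm_exp_sub_one_sub_id_le (x := u) (by linarith)
  have h2 : ‖1 - u‖ ≤ 2 := (norm_sub_le _ _).trans (by rw [norm_one]; linarith)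
  calc ‖(1 - u) * exp u - 1‖ = ‖(1 - u) * (exp u - 1 - u) - u ^ 2‖ := by ring_nf
    _ ≤ ‖1 - u‖ * ‖exp u - 1 - u‖ + ‖u‖ ^ 2 :=
      (norm_sub_le _ _).trans (by rw [norm_mul, norm_pow])
    _ ≤ 2 * ‖u‖ ^ 2 + ‖u‖ ^ 2 := by gcongr
    _ = 3 * ‖u‖ ^ 2 := by ring

/-- With u = z/a the root is exp((log(1 - u) + u)/n): the exponential factor cancels the linear term
of the logarithm, leaving a quadratic error. -/
lemma norm_factorRoot_sub_one_le {n : ℕ} (hn : n ≠ 0) {a : ℝ} {z : ℂ} (ha : a ≠ 0)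
    (h : 2 * ‖z‖ ≤ |a|) : ‖factorRoot n a z - 1‖ ≤ 3 * ‖z‖ ^ 2 / a ^ 2 := by
  have hu : ‖z / a‖ ≤ 1 / 2 := by
    rw [norm_div, norm_real, Real.norm_eq_abs, div_le_iff₀ (abs_pos.mpr ha)]
    linarith
  have hu2 : ‖z / a‖ ^ 2 = ‖z‖ ^ 2 / a ^ 2 := by
    rw [norm_div, norm_real, Real.norm_eq_abs, div_pow, sq_abs]
  have hn' : (n : ℂ) ≠ 0 := Nat.cast_ne_zero.mpr hn
  have ha' : (a : ℂ) ≠ 0 := ofReal_ne_zero.mpr ha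
  have he : z / (n * a) = z / a / n := by field_simp
  rw [factorRoot, if_neg ha, mul_div_assoc, ← hu2, he]
  set u := z / a
  have hne : 1 - u ≠ 0 := by
    intro h0
    rw [← sub_eq_zero.mp h0, norm_one] at hu
    norm_num at hu
  set w := (log (1 + -u) - -u) / n
  have hw : ‖w‖ ≤ ‖u‖ ^ 2 := by
    have h1 := norm_log_one_add_sub_self_le (z := -u) (by rw [norm_neg]; linarith)
    rw [norm_neg] at h1
    have h2 : (1 - ‖u‖)⁻¹ ≤ 2 := inv_le_of_inv_le₀ two_pos (by linarith)
    have h3 : (1 : ℝ) ≤ n := by exact_mod_cast Nat.one_le_iff_ne_zero.mpr hn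
    rw [norm_div, norm_natCast]
    refine (div_le_self (norm_nonneg _) h3).trans (h1.trans ?_)
    nlinarith [sq_nonneg ‖u‖]
  have hw1 : ‖w‖ ≤ 1 := hw.trans (pow_le_one₀ (norm_nonneg _) (by linarith))
  have hexp : (1 - u) ^ (1 / n : ℂ) * exp (u / n) = exp w := by
    rw [cpow_def_of_ne_zero hne, ← exp_add]
    congr 1
    simp only [w, ← sub_eq_add_neg]
    ring
  rw [hexp]
  have h1 := norm_exp_sub_one_le hw1
  nlinarith [sq_nonneg ‖u‖]

variable {S : SpectralData}

namespace IsCandidate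

variable (hS : S.IsCandidate)
include hS

/-- Points of the k-th gap have modulus at least a multiple of |k|, so the deviations from 1 are
O(1/k²). -/
lemma summable_ite_sub_one {φ : ℝ → ℂ} {z : ℂ}
    (hφ : ∀ a : ℝ, a ≠ 0 → 2 * ‖z‖ ≤ |a| → ‖φ a - 1‖ ≤ 3 * ‖z‖ ^ 2 / a ^ 2) {p : ℤ → Prop} [DecidablePred p]
    (hp : ∀ k, p k → k ∈ S.gapIdx) {y : ℤ → ℝ} (hy : ∀ k ∈ S.gapIdx, y k ∈ S.gap k) :
    Summable fun k => (if p k then φ (y k) else 1) - 1 := by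
  obtain ⟨a, ha, N, hN⟩ := hS.linear_growth
  obtain ⟨n, hn⟩ := exists_nat_gt (N + 2 * ‖z‖ / a)
  have hza : 0 ≤ 2 * ‖z‖ / a := by positivity
  refine summable_of_norm_le_div_sq (D := 3 * ‖z‖ ^ 2 / a ^ 2) (N := n) fun k hk => ?_
  have hkn : (n : ℝ) ≤ |(k : ℝ)| := by exact_mod_cast hk
  have hNk : (N : ℝ) ≤ |(k : ℝ)| := by linarith
  have hkz : 2 * ‖z‖ / a < |(k : ℝ)| := by linarith [N.cast_nonneg (α := ℝ)]
  have hk0 : 0 < |(k : ℝ)| := by linarith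
  split_ifs with h
  · have hky := hN k (hp k h) (by exact_mod_cast hNk) _ (hy k (hp k h))
    rw [div_lt_iff₀ ha] at hkz
    have h0 : 0 < |y k| := lt_of_lt_of_le (by positivity) hky
    refine (hφ _ (abs_pos.mp h0) (by linarith)).trans ?_
    rw [div_div, ← mul_pow, ← sq_abs (y k), ← sq_abs (a * k), abs_mul, abs_of_pos ha]
    gcongr
  · simp only [sub_self, norm_zero]
    positivity

lemma multipliable_ite {φ : ℝ → ℂ} {z : ℂ}
    (hφ : ∀ a : ℝ, a ≠ 0 → 2 * ‖z‖ ≤ |a| → ‖φ a - 1‖ ≤ 3 * ‖z‖ ^ 2 / a ^ 2) {p : ℤ → Prop} [DecidablePred p]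
    (hp : ∀ k, p k → k ∈ S.gapIdx) {y : ℤ → ℝ} (hy : ∀ k ∈ S.gapIdx, y k ∈ S.gap k) :
    Multipliable fun k => if p k then φ (y k) else 1 := by
  simpa using multipliable_one_add_of_summable (hS.summable_ite_sub_one hφ hp hy).norm

lemma tprod_ite_factor_ne_zero {z : ℂ} {p : ℤ → Prop} [DecidablePred p] (hp : ∀ k, p k → k ∈ S.gapIdx)
    (hz : ∀ k ∈ S.gapIdx, z ≠ S.γ k) : ∏' k, (if p k then factor (S.γ k) z else 1) ≠ 0 := by
  have h := tprod_one_add_ne_zero_of_summable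
    (f := fun k => (if p k then factor (S.γ k) z else 1) - 1) (fun k => ?_)
    (hS.summable_ite_sub_one (fun a ha h => norm_factor_sub_one_le ha h) hp hS.dirichlet_mem).norm
  · simpa using h
  · simp only [add_sub_cancel]
    split_ifs with h
    · exact factor_ne_zero (hz k (hp k h))
    · exact one_ne_zero

open Classical in
lemma fPlus_ne_zero {z : ℂ} (hz : ∀ k ∈ S.gapIdx, z ≠ S.γ k) : S.fPlus z ≠ 0 :=
  hS.tprod_ite_factor_ne_zero (p := fun k => k ∈ S.gapIdx ∧ S.σ k = 1) (fun _ h => h.1) hz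

open Classical in
lemma fMinus_ne_zero {z : ℂ} (hz : ∀ k ∈ S.gapIdx, z ≠ S.γ k) : S.fMinus z ≠ 0 :=
  hS.tprod_ite_factor_ne_zero (p := fun k => k ∈ S.gapIdx ∧ S.σ k = -1) (fun _ h => h.1) hz

open Classical in
-- The three values of σ partition the gaps, and the powers are chosen so that each gap contributes
-- |w_γ|², whatever its sign.
lemma hasProd_numerator (z : ℂ) : HasProd
    (fun k => if k ∈ S.gapIdx then ‖factor (S.γ k) z‖ ^ 2 else 1)
    (‖S.pRoot z‖ ^ 4 * ‖S.fPlus z‖ ^ 2 * ‖S.fMinus z‖ ^ 2) := by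
  have hf := fun (p : ℤ → Prop) [DecidablePred p] (hp : ∀ k, p k → k ∈ S.gapIdx) =>
    hS.multipliable_ite (φ := fun a => factor a z) (fun a ha h => norm_factor_sub_one_le ha h) hp
      hS.dirichlet_mem
  have h1 := (hf (fun k => k ∈ S.gapIdx ∧ S.σ k = 1) fun k h => h.1).hasProd.norm.pow 2
  have h2 := (hf (fun k => k ∈ S.gapIdx ∧ S.σ k = -1) fun k h => h.1).hasProd.norm.pow 2
  have h3 := (hS.multipliable_ite (φ := fun a => factorRoot 2 a z) (fun a ha h =>
    norm_factorRoot_sub_one_le two_ne_zero ha h) (p := fun k => k ∈ S.zeroIdx) (fun k h => h.1)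
      hS.dirichlet_mem).hasProd.norm.pow 4
  refine ((h3.mul h1).mul h2).congr_fun fun k => ?_
  have e : ‖factorRoot 2 (S.γ k) z‖ ^ 4 = ‖factor (S.γ k) z‖ ^ 2 := by
    rw [← norm_factorRoot_pow two_ne_zero, ← pow_mul]
  by_cases hk : k ∈ S.gapIdx
  · have h0 : k ∈ S.zeroIdx ↔ S.σ k = 0 := ⟨fun h => h.2, fun h => ⟨hk, h⟩⟩
    simp only [hk, h0, true_and, if_true]
    rcases SignType.trichotomy (S.σ k) with h | h | h <;> simp [h, e]
  · have h0 : k ∉ S.zeroIdx := fun h => hk h.1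
    simp [hk, h0]

open Classical in
lemma hasProd_denominator (z : ℂ) : HasProd
    (fun k => if k ∈ S.gapIdx then ‖factor (S.E (2 * k - 1)) z‖ * ‖factor (S.E (2 * k)) z‖ else 1)
    (‖S.hRoot z‖ ^ 4) := by
  have hf := fun (y : ℤ → ℝ) (hy : ∀ k ∈ S.gapIdx, y k ∈ S.gap k) =>
    hS.multipliable_ite (φ := fun a => factorRoot 4 a z) (fun a ha h =>
      norm_factorRoot_sub_one_le four_ne_zero ha h) (p := fun k => k ∈ S.gapIdx) (fun k h => h) hy
  have h1 := (hf (fun k => S.E (2 * k - 1)) fun k hk => hS.left_mem_gap hk).mul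
    (hf (fun k => S.E (2 * k)) fun k hk => hS.right_mem_gap hk)
  have e : (fun k => (if k ∈ S.gapIdx then factorRoot 4 (S.E (2 * k - 1)) z else 1) *
      (if k ∈ S.gapIdx then factorRoot 4 (S.E (2 * k)) z else 1)) = fun k =>
      if k ∈ S.gapIdx then factorRoot 4 (S.E (2 * k - 1)) z * factorRoot 4 (S.E (2 * k)) z
      else 1 := by
    funext k
    split_ifs <;> simp
  rw [e] at h1
  refine (h1.hasProd.norm.pow 4).congr_fun fun k => ?_
  split_ifs
  · rw [norm_mul, mul_pow, norm_factorRoot_pow four_ne_zero, norm_factorRoot_pow four_ne_zero]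
  · simp

end IsCandidate

/-- Points of the sectors `‖z‖ ≤ 2 |Im z|` are far from the real axis. -/
lemma le_norm_sub_of_mem_sector {z : ℂ} (hz : ‖z‖ ≤ 2 * |z.im|) (h1 : 1 ≤ ‖z‖) (e : ℝ) :
    max 1 |e| / 2 ≤ ‖z - e‖ := by
  have h3 : z.re ^ 2 ≤ 3 * z.im ^ 2 := by
    have := pow_le_pow_left₀ (norm_nonneg z) hz 2
    rw [mul_pow, sq_abs, Complex.sq_norm, normSq_apply] at this
    nlinarith
  have h4 : |z.im| ≤ ‖z - e‖ := by simpa using abs_im_le_norm (z - e)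
  rw [← max_div_div_right zero_le_two, max_le_iff]
  refine ⟨by linarith, ?_⟩
  refine abs_le_of_sq_le_sq' ?_ (norm_nonneg _) |>.2
  rw [Complex.sq_norm, normSq_apply]
  simp only [sub_re, ofReal_re, sub_im, ofReal_im, sub_zero, div_pow, sq_abs]
  -- In the sector (Im z)² ≥ (Re z)²/3, and (x - e)² + x²/3 has minimum e²/4, attained at x = 3e/4.
  nlinarith [sq_nonneg (4 * z.re - 3 * e)]

/-- In the sector the distance from z to e is at least max(1, |e|)/2, so moving e to a costs a
relative error of at most 2l/max(1, |e|). Both corrections are put in an exponent so that their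
product over the gaps becomes a sum. -/
lemma norm_sub_le_exp_mul {z : ℂ} (hz : ‖z‖ ≤ 2 * |z.im|) (h1 : 1 ≤ ‖z‖) {a e l : ℝ}
    (hl : |a - e| ≤ l) :
    ‖z - a‖ / factorScale a ≤ Real.exp (2 * l / max 1 |e| + (factorScale e / factorScale a - 1)) *
      (‖z - e‖ / factorScale e) := by
  have ha := factorScale_pos a
  have he := factorScale_pos e
  have hm : 0 < max 1 |e| := lt_max_of_lt_left one_pos
  have h2 := le_norm_sub_of_mem_sector hz h1 e
  have hl0 : 0 ≤ l := (abs_nonneg _).trans hl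
  have h3 : ‖z - a‖ ≤ (1 + 2 * l / max 1 |e|) * ‖z - e‖ := by
    have : ‖z - a‖ ≤ ‖z - e‖ + |a - e| := by
      have := norm_sub_le (z - e) (a - e : ℝ)
      rw [norm_real, Real.norm_eq_abs] at this
      refine le_trans (le_of_eq ?_) this
      push_cast
      ring_nf
    have h5 : l ≤ 2 * l / max 1 |e| * ‖z - e‖ := by
      calc l = 2 * l / max 1 |e| * (max 1 |e| / 2) := by field_simp
        _ ≤ _ := by gcongr
    linarith
  have e1 := Real.add_one_le_exp (2 * l / max 1 |e|)
  have e2 := Real.add_one_le_exp (factorScale e / factorScale a - 1)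
  rw [sub_add_cancel] at e2
  rw [Real.exp_add]
  calc ‖z - a‖ / factorScale a ≤ (1 + 2 * l / max 1 |e|) * ‖z - e‖ / factorScale a := by gcongr
    _ = (2 * l / max 1 |e| + 1) * (factorScale e / factorScale a) * (‖z - e‖ / factorScale e) := by
      field_simp
      ring
    _ ≤ _ := by gcongr

/-- The exponent in the comparison of the factors of `a` and `e`. -/
def factorExponent (a e l : ℝ) : ℝ := 2 * l / max 1 |e| + (factorScale e / factorScale a - 1)

/-- The convergence factors e^{z/a} do not cancel exactly; their mismatch is linear in z and adds up
to the exponential e^{Cz} that accompanies det B. -/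
lemma norm_factor_sq_le {z : ℂ} (hz : ‖z‖ ≤ 2 * |z.im|) (h1 : 1 ≤ ‖z‖) {a e e' l : ℝ}
    (hl : |a - e| ≤ l) (hl' : |a - e'| ≤ l) :
    ‖factor a z‖ ^ 2 * Real.exp ((1 / e + 1 / e' - 2 / a) * z.re) ≤
      Real.exp (factorExponent a e l + factorExponent a e' l) * (‖factor e z‖ * ‖factor e' z‖) := by
  have h2 := norm_sub_le_exp_mul hz h1 hl
  have h3 := norm_sub_le_exp_mul hz h1 hl'
  have ha := factorScale_pos a
  have he := factorScale_pos e
  rw [norm_factor, norm_factor, norm_factor, mul_pow, ← Real.exp_nat_mul, Real.exp_add,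
    factorExponent, factorExponent, mul_assoc, ← Real.exp_add]
  have e1 : ((2 : ℕ) : ℝ) * (z.re / a) + (1 / e + 1 / e' - 2 / a) * z.re = z.re / e + z.re / e' := by
    push_cast
    ring
  rw [e1, Real.exp_add, sq]
  have := mul_le_mul h2 h3 (by positivity) (by positivity)
  have h4 := mul_le_mul_of_nonneg_right this
    (mul_nonneg (Real.exp_nonneg (z.re / e)) (Real.exp_nonneg (z.re / e')))
  linarith

/-- With m of order |k| this is of order l/|k|. Bounded gap lengths would only give a harmonic
series, hence the need for their decay; the differences 1/e - 1/a are O(l/k²) and need no decay. -/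
lemma abs_factorExponent_le {a e l m : ℝ} (hm : 0 < m) (ha : m ≤ |a|) (he : m ≤ |e|)
    (hl : |a - e| ≤ l) : |factorExponent a e l| ≤ 3 * l / m := by
  have ha0 : a ≠ 0 := abs_pos.mp (hm.trans_le ha)
  have he0 : e ≠ 0 := abs_pos.mp (hm.trans_le he)
  have hl0 : 0 ≤ l := (abs_nonneg _).trans hl
  rw [factorExponent, factorScale_of_ne_zero ha0, factorScale_of_ne_zero he0]
  have hapos := abs_pos.mpr ha0
  have h1 : |2 * l / (max 1 |e|)| ≤ 2 * l / m := by
    rw [abs_of_nonneg (by positivity)]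
    gcongr
    exact he.trans (le_max_right _ _)
  have h2 : |(|e| / |a| - 1)| ≤ l / m := by
    rw [div_sub_one hapos.ne', abs_div, abs_abs]
    have : |(|e| - |a|)| ≤ l := (abs_abs_sub_abs_le_abs_sub e a).trans (by rwa [abs_sub_comm])
    gcongr
  calc _ ≤ 2 * l / m + l / m := (abs_add_le _ _).trans (add_le_add h1 h2)
    _ = 3 * l / m := by ring

lemma abs_inv_sub_inv_le {a e l m : ℝ} (hm : 0 < m) (ha : m ≤ |a|) (he : m ≤ |e|)
    (hl : |a - e| ≤ l) : |1 / e - 1 / a| ≤ l / m ^ 2 := by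
  have ha0 : a ≠ 0 := abs_pos.mp (hm.trans_le ha)
  have he0 : e ≠ 0 := abs_pos.mp (hm.trans_le he)
  have hl0 : 0 ≤ l := (abs_nonneg _).trans hl
  rw [div_sub_div _ _ he0 ha0, one_mul, mul_one, abs_div, abs_mul, sq]
  gcongr

namespace IsCandidate

variable (hS : S.IsCandidate)
include hS

open Classical in
/-- If the gap lengths decay, then the numerator in the determinant of `B` is bounded by the
denominator in the sectors, up to an exponential function. -/
theorem exists_numerator_le {D : ℝ} {N₀ : ℕ} (hD : 0 ≤ D) (hlen : ∀ k ∈ S.gapIdx, (N₀ : ℤ) ≤ |k| →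
    S.E (2 * k) - S.E (2 * k - 1) ≤ D / |(k : ℝ)|) :
    ∃ C K : ℝ, 0 < K ∧ ∀ z : ℂ, ‖z‖ ≤ 2 * |z.im| → 1 ≤ ‖z‖ →
      ‖S.pRoot z‖ ^ 4 * ‖S.fPlus z‖ ^ 2 * ‖S.fMinus z‖ ^ 2 * Real.exp (C * z.re) ≤
        K * ‖S.hRoot z‖ ^ 4 := by
  obtain ⟨a, ha, N, hN⟩ := hS.linear_growth
  set l : ℤ → ℝ := fun k => S.E (2 * k) - S.E (2 * k - 1)
  set e : ℤ → ℝ := fun k => S.E (2 * k - 1)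
  set e' : ℤ → ℝ := fun k => S.E (2 * k)
  set c : ℤ → ℝ := fun k => if k ∈ S.gapIdx then 1 / e k + 1 / e' k - 2 / S.γ k else 0
  set b : ℤ → ℝ := fun k => if k ∈ S.gapIdx then
    factorExponent (S.γ k) (e k) (l k) + factorExponent (S.γ k) (e' k) (l k) else 0
  have hle : ∀ k ∈ S.gapIdx, |S.γ k - e k| ≤ l k ∧ |S.γ k - e' k| ≤ l k := by
    intro k hk
    have h1 := (hS.dirichlet_mem k hk).1
    have h2 := (hS.dirichlet_mem k hk).2
    exact ⟨abs_le.mpr ⟨by simp only [e, l]; linarith, by simp only [e, l]; linarith⟩,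
      abs_le.mpr ⟨by simp only [e', l]; linarith, by simp only [e', l]; linarith⟩⟩
  have hfar : ∀ k ∈ S.gapIdx, ((N + 1 : ℕ) : ℤ) ≤ |k| → 0 < a * |(k : ℝ)| ∧
      a * |(k : ℝ)| ≤ |S.γ k| ∧ a * |(k : ℝ)| ≤ |e k| ∧ a * |(k : ℝ)| ≤ |e' k| := by
    intro k hk hkN
    have hk0 : (1 : ℝ) ≤ |(k : ℝ)| := by
      have : (1 : ℤ) ≤ |k| := by push_cast at hkN; omega
      exact_mod_cast this
    have hkN' : (N : ℤ) ≤ |k| := by push_cast at hkN; omega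
    exact ⟨by positivity, hN k hk hkN' _ (hS.dirichlet_mem k hk), hN k hk hkN' _ (hS.left_mem_gap hk),
      hN k hk hkN' _ (hS.right_mem_gap hk)⟩
  have hc : Summable c := by
    refine summable_of_norm_le_div_sq (D := 2 * S.R / a ^ 2) (N := N + 1) fun k hk => ?_
    simp only [c]
    split_ifs with hkg
    · obtain ⟨h0, h1, h2, h3⟩ := hfar k hkg hk
      have g1 := abs_inv_sub_inv_le h0 h1 h2 ((hle k hkg).1.trans (hS.length_le hkg))
      have g2 := abs_inv_sub_inv_le h0 h1 h3 ((hle k hkg).2.trans (hS.length_le hkg))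
      rw [Real.norm_eq_abs]
      calc |1 / e k + 1 / e' k - 2 / S.γ k|
          = |(1 / e k - 1 / S.γ k) + (1 / e' k - 1 / S.γ k)| := by ring_nf
        _ ≤ _ := abs_add_le _ _
        _ ≤ S.R / (a * |(k : ℝ)|) ^ 2 + S.R / (a * |(k : ℝ)|) ^ 2 := add_le_add g1 g2
        _ = 2 * S.R / a ^ 2 / (k : ℝ) ^ 2 := by rw [mul_pow, sq_abs, ← div_div]; ring
    · have := hS.R_pos
      rw [norm_zero]
      positivity
  have hb : Summable b := by
    refine summable_of_norm_le_div_sq (D := 6 * D / a) (N := N + 1 + N₀) fun k hk => ?_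
    simp only [b]
    split_ifs with hkg
    · obtain ⟨h0, h1, h2, h3⟩ := hfar k hkg (by push_cast at hk ⊢; omega)
      have g1 := abs_factorExponent_le h0 h1 h2 (hle k hkg).1
      have g2 := abs_factorExponent_le h0 h1 h3 (hle k hkg).2
      have hl : l k ≤ D / |(k : ℝ)| := hlen k hkg (by push_cast at hk; omega)
      rw [Real.norm_eq_abs]
      calc _ ≤ 3 * l k / (a * |(k : ℝ)|) + 3 * l k / (a * |(k : ℝ)|) :=
            (abs_add_le _ _).trans (add_le_add g1 g2)
        _ ≤ 3 * (D / |(k : ℝ)|) / (a * |(k : ℝ)|) + 3 * (D / |(k : ℝ)|) / (a * |(k : ℝ)|) := by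
          gcongr
        _ = 6 * D / a / |(k : ℝ)| ^ 2 := by rw [sq, ← div_div, ← div_div]; ring
        _ = 6 * D / a / (k : ℝ) ^ 2 := by rw [sq_abs]
    · rw [norm_zero]
      positivity
  refine ⟨∑' k, c k, Real.exp (∑' k, b k), Real.exp_pos _, fun z hz h1 => ?_⟩
  have hleft := (hS.hasProd_numerator z).mul (hc.hasSum.mul_right z.re).rexp
  have hright := hb.hasSum.rexp.mul (hS.hasProd_denominator z)
  refine le_of_tendsto_of_tendsto' hleft hright fun s => Finset.prod_le_prod (fun k _ => ?_)
    fun k _ => ?_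
  · simp only [Function.comp_apply]
    split_ifs <;> positivity
  · simp only [Function.comp_apply, c, b]
    split_ifs with hk
    · exact norm_factor_sq_le hz h1 (hle k hk).1 (hle k hk).2
    · simp

end IsCandidate

lemma norm_scalarB (S : SpectralData) (z : ℂ) :
    ‖S.scalarB z‖ ^ 2 = ‖S.pRoot z‖ ^ 2 / (2 * ‖S.hRoot z‖ ^ 2) := by
  have h1 : ‖exp (I * Real.pi / 4)‖ = 1 := by
    rw [show I * Real.pi / 4 = ((Real.pi / 4 : ℝ) : ℂ) * I by push_cast; ring]
    exact norm_exp_ofReal_mul_I _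
  have h2 : ‖(if 0 < z.im then 1 else (-1) ^ S.m 0 * I ^ (-S.firstPosEdge) : ℂ)‖ = 1 := by
    split_ifs <;> simp
  rw [scalarB, norm_mul, norm_mul, norm_div, h1, h2, norm_div, norm_real, mul_one, mul_pow, div_pow,
    div_pow, one_pow, Real.norm_of_nonneg (Real.sqrt_nonneg 2), Real.sq_sqrt zero_le_two, div_mul_div_comm,
    one_mul]

lemma norm_det_B (S : SpectralData) (z : ℂ) :
    ‖(S.B z).det‖ = ‖S.scalarB z‖ ^ 2 * (‖S.fPlus z‖ * ‖S.fMinus z‖) := by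
  rw [B]
  split_ifs
  · rw [Matrix.det_smul, Matrix.det_fin_two_of]
    simp only [norm_mul, norm_pow, norm_I, one_mul, Fintype.card_fin, mul_zero, sub_zero]
    ring
  · rw [Matrix.det_smul, Matrix.det_fin_two_of]
    simp

/-- If the gap lengths decay, then `det B` is bounded in the sectors, up to an exponential
function. -/
theorem IsCandidate.exists_norm_det_B_le (hS : S.IsCandidate) {D : ℝ} {N₀ : ℕ} (hD : 0 ≤ D)
    (hlen : ∀ k ∈ S.gapIdx, (N₀ : ℤ) ≤ |k| →
      S.E (2 * k) - S.E (2 * k - 1) ≤ D / |(k : ℝ)|) :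
    ∃ C K : ℝ, ∀ z : ℂ, ‖z‖ ≤ 2 * |z.im| → 1 ≤ ‖z‖ → ‖exp (C * z) * (S.B z).det‖ ≤ K := by
  obtain ⟨C, K, hK, h⟩ := hS.exists_numerator_le hD hlen
  -- The product estimate concerns |det B|², so exponent and bound are halved and rooted.
  refine ⟨C / 2, Real.sqrt K, fun z hz h1 => Real.le_sqrt_of_sq_le ?_⟩
  have e1 : ‖exp ((C / 2 : ℝ) * z)‖ ^ 2 = Real.exp (C * z.re) := by
    rw [norm_exp, re_ofReal_mul, ← Real.exp_nat_mul]
    congr 1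
    push_cast
    ring
  rw [norm_mul, norm_det_B, norm_scalarB, mul_pow, e1]
  have h2 := h z hz h1
  have e2 : Real.exp (C * z.re) * (‖S.pRoot z‖ ^ 2 / (2 * ‖S.hRoot z‖ ^ 2) *
      (‖S.fPlus z‖ * ‖S.fMinus z‖)) ^ 2 = ‖S.pRoot z‖ ^ 4 * ‖S.fPlus z‖ ^ 2 * ‖S.fMinus z‖ ^ 2 *
        Real.exp (C * z.re) / (4 * ‖S.hRoot z‖ ^ 4) := by
    ring
  rw [e2]
  refine div_le_of_le_mul₀ (by positivity) hK.le (h2.trans ?_)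
  gcongr
  linarith [pow_nonneg (norm_nonneg (S.hRoot z)) 4]

end SpectralData
end DiracRHP

namespace DiracRHP

/-! ### Two by two matrices -/

/-- The matrix `diag (a, a⁻¹)`. -/
def diagInv (a : ℂ) : Matrix (Fin 2) (Fin 2) ℂ := !![a, 0; 0, a⁻¹]

lemma diagInv_one : diagInv 1 = 1 := by
  rw [diagInv, inv_one, Matrix.one_fin_two]

lemma tendsto_diagInv {α : Type*} {F : Filter α} {a : α → ℂ} {l : ℂ} (h : Tendsto a F (𝓝 l))
    (hl : l ≠ 0) : Tendsto (fun z => diagInv (a z)) F (𝓝 (diagInv l)) := by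
  refine tendsto_pi_nhds.mpr fun i => tendsto_pi_nhds.mpr fun j => ?_
  fin_cases i <;> fin_cases j
  · simpa [diagInv] using h
  · simpa [diagInv] using tendsto_const_nhds
  · simpa [diagInv] using tendsto_const_nhds
  · simpa [diagInv] using h.inv₀ hl

lemma exists_adjugate_apply (i j : Fin 2) : ∃ s : ℂ, ‖s‖ = 1 ∧ ∃ i' j' : Fin 2,
    ∀ A : Matrix (Fin 2) (Fin 2) ℂ, A.adjugate i j = s * A i' j' := by
  fin_cases i <;> fin_cases j
  · exact ⟨1, by simp, 1, 1, fun A => by simp [Matrix.adjugate_fin_two]⟩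
  · exact ⟨-1, by simp, 0, 1, fun A => by simp [Matrix.adjugate_fin_two]⟩
  · exact ⟨-1, by simp, 1, 0, fun A => by simp [Matrix.adjugate_fin_two]⟩
  · exact ⟨1, by simp, 0, 0, fun A => by simp [Matrix.adjugate_fin_two]⟩

lemma mul_diagInv_mul_apply (A C : Matrix (Fin 2) (Fin 2) ℂ) (a : ℂ) (i j : Fin 2) :
    (A * diagInv a * C) i j = A i 0 * a * C 0 j + A i 1 * a⁻¹ * C 1 j := by
  simp [Matrix.mul_apply, Fin.sum_univ_two, diagInv]

lemma det_U : U.det = 2 * I := by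
  rw [U, Matrix.det_fin_two_of]
  ring

lemma isUnit_det_U : IsUnit U.det := by
  rw [det_U]
  exact (mul_ne_zero two_ne_zero I_ne_zero).isUnit

instance : (sectorAtInfty (1 / 2)).NeBot := by
  have h : Tendsto (fun s : ℝ => (s : ℂ) * I) atTop (sectorAtInfty (1 / 2)) := by
    refine tendsto_inf.mpr ⟨?_, tendsto_principal.mpr (Eventually.of_forall fun s => ?_)⟩
    · rw [← tendsto_norm_atTop_iff_cobounded]
      simpa using tendsto_abs_atTop_atTop
    · simp only [mem_ofPred_eq, norm_mul, norm_real, norm_I, mul_one, Real.norm_eq_abs,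
        im_ofReal_mul, I_im]
      linarith [abs_nonneg s]
  exact h.neBot

lemma sectorAtInfty_le : sectorAtInfty (1 / 2) ≤ Bornology.cobounded ℂ ⊓ 𝓟 nonreal := by
  refine le_inf inf_le_left (le_principal_iff.mpr ?_)
  have h0 : ∀ᶠ z : ℂ in sectorAtInfty (1 / 2), 0 < ‖z‖ :=
    (tendsto_norm_cobounded_atTop.eventually (eventually_gt_atTop 0)).filter_mono inf_le_left
  filter_upwards [h0, mem_inf_of_right (mem_principal_self _)] with z hz hz' him
  have hz2 : 1 / 2 * ‖z‖ ≤ |z.im| := hz'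
  rw [him, abs_zero] at hz2
  linarith

lemma eventually_sectorAtInfty_iff {p : ℂ → Prop} (h : ∀ᶠ z in sectorAtInfty (1 / 2), p z) :
    ∃ T : ℝ, ∀ z : ℂ, ‖z‖ ≤ 2 * |z.im| → T ≤ ‖z‖ → p z := by
  rw [sectorAtInfty, eventually_inf_principal, ← comap_norm_atTop, eventually_comap] at h
  obtain ⟨T, hT⟩ := eventually_atTop.mp h
  refine ⟨T, fun z hz hzT => hT _ hzT z rfl ?_⟩
  rw [mem_ofPred_eq]
  linarith

/-! ### Gauge transformations of the jumps -/

namespace SpectralData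

variable {S : SpectralData}

lemma B_mul_diagInv (S : SpectralData) (z a : ℂ) : S.B z * diagInv a = diagInv a * S.B z := by
  rw [B, diagInv]
  split_ifs <;> ext i j <;> fin_cases i <;> fin_cases j <;>
    simp [Matrix.mul_apply, Fin.sum_univ_two, mul_comm]

lemma neg_one_zpow_mul_self (n : ℤ) : (-1 : ℂ) ^ n * (-1 : ℂ) ^ n = 1 := by
  rw [← mul_zpow, neg_one_mul, neg_neg, one_zpow]

lemma bandJump_mul {n : ℤ} {y : ℝ} (hp : S.fPlus y ≠ 0) (hm : S.fMinus y ≠ 0) (u : ℂ) :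
    S.bandJump n y * diagInv u * (S.bandJump n y).adjugate = diagInv u := by
  rw [bandJump, diagInv, Matrix.adjugate_fin_two]
  set c := (-1 : ℂ) ^ (n + (S.m y : ℤ))
  have hc : c * c = 1 := neg_one_zpow_mul_self _
  ext i j
  fin_cases i <;> fin_cases j <;> simp [Matrix.mul_apply, Fin.sum_univ_two]
  · have h : S.fMinus y / S.fPlus y * (S.fPlus y / S.fMinus y) = 1 := by field_simp
    linear_combination u * c * c * h + u * hc
  · have h : S.fMinus y / S.fPlus y * (S.fPlus y / S.fMinus y) = 1 := by field_simp
    linear_combination u⁻¹ * c * c * h + u⁻¹ * hc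

/-- Conjugation by antidiagonal matrices swaps u and 1/u, the t-dependence cancels, and the shift in
x leaves e^{-2iyL}/u = v. -/
lemma gapJump_mul {x t L : ℝ} {n : ℤ} {y : ℝ} {u v : ℂ} (huv : u * v = exp (-(2 * I * y * L))) :
    S.gapJump (x + L) t n y * diagInv u * (S.gapJump x t n y).adjugate = diagInv v := by
  have hne : u * v ≠ 0 := huv ▸ exp_ne_zero _
  have hu : u ≠ 0 := left_ne_zero_of_mul hne
  have hv : v ≠ 0 := right_ne_zero_of_mul hne
  rw [gapJump, gapJump, diagInv, diagInv, Matrix.adjugate_fin_two]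
  set c := (-1 : ℂ) ^ (n + (S.m y : ℤ))
  have hc : c * c = 1 := neg_one_zpow_mul_self _
  set α := -2 * I * y * x - 4 * I * (y : ℂ) ^ 2 * t
  set β := -2 * I * y * ((x + L : ℝ) : ℂ) - 4 * I * (y : ℂ) ^ 2 * t
  have h1 : exp β * exp (-α) = u * v := by
    rw [huv, ← exp_add]
    congr 1
    simp only [α, β]
    push_cast
    ring
  have h2 : exp (-β) * exp α = u⁻¹ * v⁻¹ := by
    rw [← mul_inv, ← h1, mul_inv, ← exp_neg, ← exp_neg, neg_neg]
  ext i j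
  fin_cases i <;> fin_cases j <;>
    simp [Matrix.mul_apply, Fin.sum_univ_two, expSigma3, sigma1]
  · have : c * I * exp β * u⁻¹ * (c * I * exp (-α)) = -(c * c) * (exp β * exp (-α)) * u⁻¹ := by
      linear_combination (c * c * exp β * exp (-α) * u⁻¹) * I_mul_I
    rw [this, h1, hc]
    field_simp
  · have : c * I * exp (-β) * u * (c * I * exp α) = -(c * c) * (exp (-β) * exp α) * u := by
      linear_combination (c * c * exp (-β) * exp α * u) * I_mul_I
    rw [this, h2, hc]
    field_simp

/-- Scalar functions that conjugate the jumps at `x` into the jumps at `x + L`. -/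
structure IsGauge (S : SpectralData) (L : ℝ) (a : ℂ → ℂ) : Prop where
  holo : ∀ z : ℂ, z.im ≠ 0 → DifferentiableAt ℂ a z
  ne_zero : ∀ z : ℂ, z.im ≠ 0 → a z ≠ 0
  band : ∀ y ∉ S.gaps, ∃ l, l ≠ 0 ∧ Tendsto a (𝓝[nonreal] (y : ℂ)) (𝓝 l)
  gap : ∀ y ∈ S.gaps, ∃ u v : ℂ, Tendsto a (𝓝[upper] (y : ℂ)) (𝓝 u) ∧
    Tendsto a (𝓝[lower] (y : ℂ)) (𝓝 v) ∧ u * v = exp (-(2 * I * y * L))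
  tendsto : Tendsto a (Bornology.cobounded ℂ ⊓ 𝓟 nonreal) (𝓝 1)

lemma isGauge_one (S : SpectralData) : S.IsGauge 0 fun _ => 1 where
  holo _ _ := by fun_prop
  ne_zero _ _ := one_ne_zero
  band _ _ := ⟨1, one_ne_zero, tendsto_const_nhds⟩
  gap _ _ := ⟨1, 1, tendsto_const_nhds, tendsto_const_nhds, by simp⟩
  tendsto := tendsto_const_nhds

lemma SolvesScalarRHP.isGauge {L : ℝ} {r : ℂ → ℂ} (hr : S.SolvesScalarRHP L r)
    (hS : S.IsCandidate) : S.IsGauge L fun z => r z * exp (-(I * z * L)) where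
  holo z hz := (hr.holo.differentiableAt (hS.isOpen_resolventSet.mem_nhds
    (nonreal_subset_resolventSet hz))).mul (by fun_prop)
  ne_zero z hz := mul_ne_zero (hr.ne_zero hS (nonreal_subset_resolventSet hz)) (exp_ne_zero _)
  band y hy := by
    have hy' := ofReal_mem_resolventSet.mpr hy
    have hexp : Continuous fun z : ℂ => exp (-(I * z * L)) := by fun_prop
    exact ⟨_, mul_ne_zero (hr.ne_zero hS hy') (exp_ne_zero _),
      ((hr.continuousAt hS hy').mul hexp.continuousAt).tendsto.mono_left inf_le_left⟩
  gap y hy := by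
    obtain ⟨u, v, hu, hv, huv⟩ := hr.exists_boundary hy
    have hexp : Continuous fun z : ℂ => exp (-(I * z * L)) := by fun_prop
    refine ⟨_, _, hu.mul ((hexp.tendsto _).mono_left inf_le_left),
      hv.mul ((hexp.tendsto _).mono_left inf_le_left), ?_⟩
    rw [mul_mul_mul_comm, huv, one_mul, ← exp_add]
    ring_nf
  tendsto := hr.tendsto_one.mono_left
    (inf_le_inf_left _ (principal_mono.mpr nonreal_subset_resolventSet))

namespace IsGauge

variable {L : ℝ} {a : ℂ → ℂ} (ha : S.IsGauge L a)
include ha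

lemma isBigO_one (y : ℝ) : a =O[𝓝[nonreal] (y : ℂ)] (fun _ => (1 : ℝ)) ∧
    (fun z => (a z)⁻¹) =O[𝓝[nonreal] (y : ℂ)] (fun _ => (1 : ℝ)) := by
  by_cases hy : y ∈ S.gaps
  · obtain ⟨u, v, hu, hv, huv⟩ := ha.gap y hy
    have hne : u * v ≠ 0 := huv ▸ exp_ne_zero _
    rw [nhdsWithin_nonreal]
    exact ⟨(hu.isBigO_one ℝ).sup (hv.isBigO_one ℝ),
      ((hu.inv₀ (left_ne_zero_of_mul hne)).isBigO_one ℝ).sup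
        ((hv.inv₀ (right_ne_zero_of_mul hne)).isBigO_one ℝ)⟩
  · obtain ⟨l, hl, h⟩ := ha.band y hy
    exact ⟨h.isBigO_one ℝ, (h.inv₀ hl).isBigO_one ℝ⟩

lemma exists_bound : ∃ T : ℝ, ∀ z : ℂ, z.im ≠ 0 → T < ‖z‖ → ‖a z‖ ≤ 2 ∧ ‖(a z)⁻¹‖ ≤ 2 := by
  have h1 := ha.tendsto.norm.eventually (eventually_le_nhds (b := (2 : ℝ)) (by norm_num))
  have h2 := (ha.tendsto.inv₀ one_ne_zero).norm.eventually
    (eventually_le_nhds (b := (2 : ℝ)) (by norm_num))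
  have h := h1.and h2
  rw [eventually_inf_principal, ← comap_norm_atTop, eventually_comap] at h
  obtain ⟨T, hT⟩ := eventually_atTop.mp h
  exact ⟨T, fun z hz hzT => hT _ hzT.le z rfl hz⟩

end IsGauge

/-! ### Uniqueness for the matrix problem -/

namespace SolvesRHP

variable {x t : ℝ} {Φ : ℂ → Matrix (Fin 2) (Fin 2) ℂ} (hΦ : S.SolvesRHP x t Φ)
include hΦ

lemma differentiableAt {z : ℂ} (hz : z.im ≠ 0) (i j : Fin 2) :
    DifferentiableAt ℂ (fun z => Φ z i j) z := by
  have := hΦ.holo i j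
  rw [upper_union_lower] at this
  exact this.differentiableAt (nonreal_mem_nhds hz)

lemma tendsto_normalized :
    Tendsto (fun z => U⁻¹ * Φ z * (S.B z)⁻¹) (sectorAtInfty (1 / 2)) (𝓝 1) := by
  refine tendsto_pi_nhds.mpr fun i => tendsto_pi_nhds.mpr fun j => ?_
  have h : Tendsto (fun z : ℂ => z⁻¹) (sectorAtInfty (1 / 2)) (𝓝 0) :=
    tendsto_inv₀_cobounded.mono_left inf_le_left
  exact tendsto_sub_nhds_zero_iff.mp ((hΦ.asymp (1 / 2) (by norm_num) i j).trans_tendsto h)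

lemma eventually_eq_normalized : ∀ᶠ z in sectorAtInfty (1 / 2),
    (S.B z).det ≠ 0 ∧ Φ z = U * (U⁻¹ * Φ z * (S.B z)⁻¹) * S.B z := by
  have h : Tendsto (fun z => (U⁻¹ * Φ z * (S.B z)⁻¹).det) (sectorAtInfty (1 / 2)) (𝓝 1) := by
    have := (continuous_id.matrix_det.tendsto (1 : Matrix (Fin 2) (Fin 2) ℂ)).comp
      hΦ.tendsto_normalized
    simpa [Function.comp_def] using this
  filter_upwards [h.eventually_ne one_ne_zero] with z hz
  -- The inverse of a singular matrix is 0 by convention, so a singular B would make the normalized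
  -- matrix vanish, although its determinant is near 1.
  have hB : (S.B z).det ≠ 0 := by
    intro h0
    refine hz ?_
    rw [Matrix.nonsing_inv_apply_not_isUnit (S.B z) (by simp [h0]), Matrix.mul_zero,
      Matrix.det_zero]
  refine ⟨hB, ?_⟩
  rw [Matrix.mul_assoc, Matrix.nonsing_inv_mul_cancel_right _ _ hB.isUnit,
    Matrix.mul_nonsing_inv_cancel_left _ _ isUnit_det_U]

/-- Comparison of two solutions. -/
lemma eventually_mul_diagInv_mul_adjugate {x' : ℝ} {Φ' : ℂ → Matrix (Fin 2) (Fin 2) ℂ}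
    (hΦ' : S.SolvesRHP x' t Φ') (a : ℂ → ℂ) : ∀ᶠ z in sectorAtInfty (1 / 2),
    Φ' z * diagInv (a z) * (Φ z).adjugate = (S.B z).det •
      (U * (U⁻¹ * Φ' z * (S.B z)⁻¹) * diagInv (a z) * (U⁻¹ * Φ z * (S.B z)⁻¹).adjugate *
        U.adjugate) := by
  filter_upwards [hΦ.eventually_eq_normalized, hΦ'.eventually_eq_normalized] with z h h'
  set A := U⁻¹ * Φ z * (S.B z)⁻¹
  set A' := U⁻¹ * Φ' z * (S.B z)⁻¹
  rw [h.2, h'.2, Matrix.adjugate_mul_distrib, Matrix.adjugate_mul_distrib]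
  calc U * A' * S.B z * diagInv (a z) * ((S.B z).adjugate * (A.adjugate * U.adjugate))
      = U * A' * (S.B z * diagInv (a z)) * ((S.B z).adjugate * (A.adjugate * U.adjugate)) := by
        rw [Matrix.mul_assoc (U * A')]
    _ = U * A' * diagInv (a z) * (S.B z * (S.B z).adjugate) * (A.adjugate * U.adjugate) := by
        rw [B_mul_diagInv]
        simp only [Matrix.mul_assoc]
    _ = _ := by
        rw [Matrix.mul_adjugate]
        simp only [Matrix.mul_smul, Matrix.smul_mul, Matrix.mul_one, Matrix.mul_assoc]

lemma tendsto_comparison {x' : ℝ} {Φ' : ℂ → Matrix (Fin 2) (Fin 2) ℂ}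
    (hΦ' : S.SolvesRHP x' t Φ') {L : ℝ} {a : ℂ → ℂ} (ha : S.IsGauge L a) :
    Tendsto (fun z => U * (U⁻¹ * Φ' z * (S.B z)⁻¹) * diagInv (a z) *
      (U⁻¹ * Φ z * (S.B z)⁻¹).adjugate * U.adjugate) (sectorAtInfty (1 / 2))
      (𝓝 (U.det • 1)) := by
  have h1 := (continuous_id.matrix_adjugate.tendsto (1 : Matrix (Fin 2) (Fin 2) ℂ)).comp
    hΦ.tendsto_normalized
  have h2 := tendsto_diagInv (ha.tendsto.mono_left sectorAtInfty_le) one_ne_zero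
  have := (((tendsto_const_nhds (x := U)).mul hΦ'.tendsto_normalized).mul h2).mul h1 |>.mul
    (tendsto_const_nhds (x := U.adjugate))
  simpa [diagInv_one, Matrix.mul_adjugate, Function.comp_def] using this

lemma exists_limit (hS : S.IsCandidate) {L : ℝ} {a : ℂ → ℂ} (ha : S.IsGauge L a)
    {Φ' : ℂ → Matrix (Fin 2) (Fin 2) ℂ} (hΦ' : S.SolvesRHP (x + L) t Φ') {y : ℝ}
    (hy : y ∉ S.edges) : ∃ X, Tendsto (fun z => Φ' z * diagInv (a z) * (Φ z).adjugate)
      (𝓝[nonreal] (y : ℂ)) (𝓝 X) := by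
  obtain ⟨Φp, Φm, -, -, hlim, hband, hgap⟩ := hΦ.boundary
  obtain ⟨Φp', Φm', -, -, hlim', hband', hgap'⟩ := hΦ'.boundary
  have key : ∀ {u v : ℂ} {V V' : Matrix (Fin 2) (Fin 2) ℂ}, u ≠ 0 → v ≠ 0 →
      Tendsto a (𝓝[upper] (y : ℂ)) (𝓝 u) → Tendsto a (𝓝[lower] (y : ℂ)) (𝓝 v) →
      Φp y = Φm y * V → Φp' y = Φm' y * V' → V' * diagInv u * V.adjugate = diagInv v →
      ∃ X, Tendsto (fun z => Φ' z * diagInv (a z) * (Φ z).adjugate)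
        (𝓝[nonreal] (y : ℂ)) (𝓝 X) := by
    intro u v V V' hu0 hv0 hu hv h h' hV
    have hadj := fun M : Matrix (Fin 2) (Fin 2) ℂ => continuous_id.matrix_adjugate.tendsto M
    have h1 := ((hlim' y hy).1.mul (tendsto_diagInv hu hu0)).mul ((hadj _).comp (hlim y hy).1)
    have h2 := ((hlim' y hy).2.mul (tendsto_diagInv hv hv0)).mul ((hadj _).comp (hlim y hy).2)
    have e : Φp' y * diagInv u * (Φp y).adjugate = Φm' y * diagInv v * (Φm y).adjugate := by
      rw [h, h', Matrix.adjugate_mul_distrib, ← hV]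
      simp only [Matrix.mul_assoc]
    refine ⟨Φm' y * diagInv v * (Φm y).adjugate, ?_⟩
    rw [nhdsWithin_nonreal]
    exact Tendsto.sup (e ▸ h1) h2
  rcases hS.mem_band_or_gap hy with ⟨n, hn⟩ | ⟨n, hn, hny⟩
  · have hng := hS.notMem_gaps_of_mem_bandInterior hn
    obtain ⟨l, hl, h⟩ := ha.band y hng
    rw [nhdsWithin_nonreal] at h
    have hγ : ∀ k ∈ S.gapIdx, (y : ℂ) ≠ S.γ k := fun k hk h => hng
      (gap_subset_gaps hk (ofReal_injective h ▸ hS.dirichlet_mem k hk))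
    exact key hl hl (h.mono_left le_sup_left) (h.mono_left le_sup_right) (hband n y hn)
      (hband' n y hn) (bandJump_mul (hS.fPlus_ne_zero hγ) (hS.fMinus_ne_zero hγ) l)
  · obtain ⟨u, v, hu, hv, huv⟩ := ha.gap y (gap_subset_gaps hn (interior_subset hny))
    have hne : u * v ≠ 0 := huv ▸ exp_ne_zero _
    exact key (left_ne_zero_of_mul hne) (right_ne_zero_of_mul hne) hu hv (hgap n hn y hny)
      (hgap' n hn y hny) (gapJump_mul huv)

/-- Two solutions differ by a gauge transformation, up to an exponential factor. -/
theorem exists_eq_const (hS : S.IsCandidate) {L : ℝ} {a : ℂ → ℂ} (ha : S.IsGauge L a)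
    {Φ' : ℂ → Matrix (Fin 2) (Fin 2) ℂ} (hΦ' : S.SolvesRHP (x + L) t Φ') {C K : ℝ}
    (hB : ∀ z : ℂ, ‖z‖ ≤ 2 * |z.im| → 1 ≤ ‖z‖ → ‖exp (C * z) * (S.B z).det‖ ≤ K) :
    ∃ X : Matrix (Fin 2) (Fin 2) ℂ, ∀ z : ℂ, z.im ≠ 0 →
      exp (C * z) • (Φ' z * diagInv (a z) * (Φ z).adjugate) = X := by
  suffices h : ∀ i j, ∃ X : ℂ, ∀ z : ℂ, z.im ≠ 0 →
      exp (C * z) * (Φ' z * diagInv (a z) * (Φ z).adjugate) i j = X by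
    choose X hX using h
    exact ⟨X, fun z hz => Matrix.ext fun i j => hX i j z hz⟩
  intro i j
  set f : ℂ → ℂ := fun z => (Φ' z * diagInv (a z) * (Φ z).adjugate) i j with hf
  obtain ⟨s₀, hs₀, i₀, j₀, h₀⟩ := exists_adjugate_apply 0 j
  obtain ⟨s₁, hs₁, i₁, j₁, h₁⟩ := exists_adjugate_apply 1 j
  have hfe : f = fun z => Φ' z i 0 * a z * (s₀ * Φ z i₀ j₀) +
      Φ' z i 1 * (a z)⁻¹ * (s₁ * Φ z i₁ j₁) := by
    funext z
    simp only [hf]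
    rw [mul_diagInv_mul_apply, h₀, h₁]
  obtain ⟨F, hF, hFf⟩ : ∃ F : ℂ → ℂ, Differentiable ℂ F ∧ ∀ z : ℂ, z.im ≠ 0 → F z = f z := by
    refine exists_entire_extension (Z := S.edges) (fun z hz => ?_) (fun y hy => ?_)
      (fun e _ => hS.eventually_notMem_edges e) fun e he => ?_
    · rw [hfe]
      have d1 := fun i j => hΦ.differentiableAt hz i j
      have d2 := fun i j => hΦ'.differentiableAt hz i j
      have d3 := ha.holo z hz
      exact (((d2 i 0).mul d3).mul ((d1 i₀ j₀).const_mul s₀)).add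
        (((d2 i 1).mul (d3.inv (ha.ne_zero z hz))).mul ((d1 i₁ j₁).const_mul s₁))
    · obtain ⟨X, hX⟩ := hΦ.exists_limit hS ha hΦ' hy
      exact ⟨X i j, (tendsto_pi_nhds.mp (tendsto_pi_nhds.mp hX i) j)⟩
    -- Two quartic-root singularities multiply to an inverse square root, which is removable; a and
    -- 1/a stay bounded.
    · have q1 := hΦ.quartic e he
      have q2 := hΦ'.quartic e he
      rw [upper_union_lower] at q1 q2
      obtain ⟨b1, b2⟩ := ha.isBigO_one e
      rw [hfe]
      have e1 : (fun z : ℂ => ‖z - e‖ ^ (-(1 / 2) : ℝ)) = fun z : ℂ =>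
          ‖z - e‖ ^ (-(1 / 4) : ℝ) * 1 * ‖z - e‖ ^ (-(1 / 4) : ℝ) := by
        funext z
        rw [mul_one]
        rcases (norm_nonneg (z - e)).eq_or_lt with h | h
        · rw [← h]
          norm_num
        · rw [← Real.rpow_add h]
          norm_num
      rw [e1]
      exact (((q2 i 0).mul b1).mul ((q1 i₀ j₀).const_mul_left s₀)).add
        (((q2 i 1).mul b2).mul ((q1 i₁ j₁).const_mul_left s₁))
  obtain ⟨c, M, hc, hM⟩ : ∃ c M : ℝ, 0 ≤ c ∧ ∀ z, ‖F z‖ ≤ M * Real.exp (c * ‖z‖ ^ 2) := by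
    obtain ⟨c₁, M₁, hc₁, hM₁, g₁⟩ := hΦ.growth
    obtain ⟨c₂, M₂, hc₂, hM₂, g₂⟩ := hΦ'.growth
    obtain ⟨T, hT⟩ := ha.exists_bound
    refine hS.growth_of_growth_on_domainD hF (c := c₁ + c₂) (M := 4 * (M₁ * M₂)) (T := T)
      (by positivity) (by positivity) fun z hz hzT => ?_
    have him : z.im ≠ 0 := fun h => hz (.inl ⟨z.re, Complex.ext (by simp) (by simp [h])⟩)
    obtain ⟨a1, a2⟩ := hT z him hzT
    rw [hFf z him, hfe, add_mul, Real.exp_add]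
    have t1 : ‖Φ' z i 0 * a z * (s₀ * Φ z i₀ j₀)‖ ≤
        (M₂ * Real.exp (c₂ * ‖z‖ ^ 2)) * 2 * (1 * (M₁ * Real.exp (c₁ * ‖z‖ ^ 2))) := by
      rw [norm_mul, norm_mul, norm_mul, hs₀]
      gcongr
      · exact g₂ z hz i 0
      · exact g₁ z hz i₀ j₀
    have t2 : ‖Φ' z i 1 * (a z)⁻¹ * (s₁ * Φ z i₁ j₁)‖ ≤
        (M₂ * Real.exp (c₂ * ‖z‖ ^ 2)) * 2 * (1 * (M₁ * Real.exp (c₁ * ‖z‖ ^ 2))) := by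
      rw [norm_mul, norm_mul, norm_mul, hs₁]
      gcongr
      · exact g₂ z hz i 1
      · exact g₁ z hz i₁ j₁
    exact (norm_add_le _ _).trans (by linarith)
  have hG : Differentiable ℂ fun z => exp (C * z) * F z := by fun_prop
  have hM0 : 0 ≤ M := by simpa using (norm_nonneg _).trans (hM 0)
  have hGM : ∀ z : ℂ, ‖exp (C * z) * F z‖ ≤
      M * Real.exp |C| * Real.exp ((c + |C|) * ‖z‖ ^ 2) := by
    intro z
    have h1 : ‖exp (C * z)‖ ≤ Real.exp (|C| + |C| * ‖z‖ ^ 2) := by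
      rw [norm_exp, re_ofReal_mul]
      refine Real.exp_le_exp.mpr ?_
      have h2 : C * z.re ≤ |C| * ‖z‖ :=
        (le_abs_self _).trans (by rw [abs_mul]; gcongr; exact abs_re_le_norm z)
      -- The first-order factor e^{Cz} is absorbed into growth of order two.
      have h3 : ‖z‖ ≤ 1 + ‖z‖ ^ 2 := by nlinarith [sq_nonneg (‖z‖ - 1), norm_nonneg z]
      nlinarith [mul_le_mul_of_nonneg_left h3 (abs_nonneg C)]
    rw [norm_mul]
    calc _ ≤ Real.exp (|C| + |C| * ‖z‖ ^ 2) * (M * Real.exp (c * ‖z‖ ^ 2)) := by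
          gcongr
          exact hM z
      _ = _ := by
          rw [add_mul, Real.exp_add, Real.exp_add]
          ring
  obtain ⟨K', hK'⟩ : ∃ K' : ℝ, ∀ z : ℂ, ‖z‖ ≤ 2 * |z.im| → ‖exp (C * z) * F z‖ ≤ K' := by
    have hlim := tendsto_pi_nhds.mp (tendsto_pi_nhds.mp (hΦ.tendsto_comparison hΦ' ha) i) j
    set l := (U.det • (1 : Matrix (Fin 2) (Fin 2) ℂ)) i j
    have hbd := hlim.norm.eventually (eventually_le_nhds (b := ‖l‖ + 1) (by linarith))
    have hne : ∀ᶠ z in sectorAtInfty (1 / 2), z.im ≠ 0 :=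
      sectorAtInfty_le (mem_inf_of_right (mem_principal_self nonreal))
    obtain ⟨T, hT⟩ := eventually_sectorAtInfty_iff
      (hbd.and (hne.and (hΦ.eventually_mul_diagInv_mul_adjugate hΦ' a)))
    obtain ⟨K₁, hK₁⟩ := (isCompact_closedBall (0 : ℂ) (max T 1)).exists_bound_of_continuousOn
      hG.continuous.continuousOn
    refine ⟨max K₁ (K * (‖l‖ + 1)), fun z hz => ?_⟩
    rcases le_total ‖z‖ (max T 1) with h | h
    · exact (hK₁ z (by simpa using h)).trans (le_max_left _ _)
    · refine le_trans ?_ (le_max_right _ _)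
      obtain ⟨g1, g2, g3⟩ := hT z hz ((le_max_left _ _).trans h)
      have hBz := hB z hz ((le_max_right _ _).trans h)
      rw [hFf z g2]
      simp only [hf]
      rw [g3, Matrix.smul_apply, smul_eq_mul, ← mul_assoc, norm_mul]
      have hK0 : 0 ≤ K := (norm_nonneg _).trans hBz
      gcongr
  refine ⟨exp (C * 0) * F 0, fun z hz => ?_⟩
  change exp (C * z) * f z = _
  rw [← hFf z hz]
  exact eq_of_order_two_of_bounded_in_sector hG hGM (by positivity) hK' z 0

/-- Solutions of the Riemann-Hilbert problem at `x` and `x + L` are related by a gauge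
transformation. -/
theorem mul_diagInv_eq (hS : S.IsCandidate) {L : ℝ} {a : ℂ → ℂ} (ha : S.IsGauge L a)
    {Φ' : ℂ → Matrix (Fin 2) (Fin 2) ℂ} (hΦ' : S.SolvesRHP (x + L) t Φ') {C K : ℝ}
    (hB : ∀ z : ℂ, ‖z‖ ≤ 2 * |z.im| → 1 ≤ ‖z‖ → ‖exp (C * z) * (S.B z).det‖ ≤ K) {z : ℂ}
    (hz : z.im ≠ 0) : Φ' z * diagInv (a z) = Φ z := by
  obtain ⟨X, hX⟩ := hΦ.exists_eq_const hS ha hΦ' hB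
  -- Comparing Φ with itself turns the product with the adjugate into det Φ.
  obtain ⟨X₀, hX₀⟩ := hΦ.exists_eq_const hS S.isGauge_one (by rwa [add_zero]) hB
  have hX₀' : ∀ z : ℂ, z.im ≠ 0 → (exp (C * z) * (Φ z).det) • 1 = X₀ := by
    intro z hz
    rw [← hX₀ z hz, diagInv_one, Matrix.mul_one, Matrix.mul_adjugate, smul_smul]
  have hne : ∀ᶠ z in sectorAtInfty (1 / 2), z.im ≠ 0 :=
    sectorAtInfty_le (mem_inf_of_right (mem_principal_self nonreal))
  have hUdet : U.det ≠ 0 := isUnit_det_U.ne_zero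
  have hdet : Tendsto (fun z => (U⁻¹ * Φ z * (S.B z)⁻¹).det) (sectorAtInfty (1 / 2)) (𝓝 1) := by
    have := (continuous_id.matrix_det.tendsto (1 : Matrix (Fin 2) (Fin 2) ℂ)).comp
      hΦ.tendsto_normalized
    simpa [Function.comp_def] using this
  set κ := X₀ 0 0
  have hκ : ∀ z : ℂ, z.im ≠ 0 → exp (C * z) * (Φ z).det = κ := by
    intro z hz
    simp only [κ]
    rw [← hX₀' z hz]
    simp
  have hdetΦ : ∀ᶠ z in sectorAtInfty (1 / 2), (U⁻¹ * Φ z * (S.B z)⁻¹).det ≠ 0 ∧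
      (S.B z).det ≠ 0 ∧ exp (C * z) * (S.B z).det =
        κ / (U.det * (U⁻¹ * Φ z * (S.B z)⁻¹).det) := by
    filter_upwards [hne, hΦ.eventually_eq_normalized, hdet.eventually_ne one_ne_zero]
      with z h1 h2 h3
    refine ⟨h3, h2.1, ?_⟩
    rw [eq_div_iff (mul_ne_zero hUdet h3), ← hκ z h1]
    have h4 := congrArg Matrix.det h2.2
    rw [Matrix.det_mul, Matrix.det_mul] at h4
    rw [h4]
    ring
  have hκ0 : κ ≠ 0 := by
    obtain ⟨z, h1, h2, h3⟩ := hdetΦ.exists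
    intro h0
    rw [h0, zero_div] at h3
    exact mul_ne_zero (exp_ne_zero _) h2 h3
  have hXκ : X = κ • 1 := by
    have h1 := hΦ.tendsto_comparison hΦ' ha
    have h2 : Tendsto (fun z => κ / (U.det * (U⁻¹ * Φ z * (S.B z)⁻¹).det)) (sectorAtInfty (1 / 2))
        (𝓝 (κ / (U.det * 1))) :=
      tendsto_const_nhds.div (tendsto_const_nhds.mul hdet) (by simpa using hUdet)
    have h3 := h2.smul h1
    rw [smul_smul, mul_one, div_mul_cancel₀ _ hUdet] at h3
    refine tendsto_nhds_unique (tendsto_const_nhds.congr' ?_) h3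
    filter_upwards [hne, hdetΦ, hΦ.eventually_mul_diagInv_mul_adjugate hΦ' a] with z g1 g2 g3
    rw [← hX z g1, g3, smul_smul, g2.2.2]
  have hdz : exp (C * z) * (Φ z).det ≠ 0 := by rwa [hκ z hz]
  have h1 : Φ' z * diagInv (a z) * (Φ z).adjugate = (Φ z).det • 1 := by
    have := hX z hz
    rw [hXκ, ← hκ z hz, mul_smul] at this
    exact smul_right_injective _ (exp_ne_zero (C * z)) this
  have h2 := congrArg (· * Φ z) h1
  simp only [Matrix.mul_assoc, Matrix.adjugate_mul, Matrix.smul_mul, Matrix.one_mul,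
    Matrix.mul_smul, Matrix.mul_one] at h2
  exact smul_right_injective _ (right_ne_zero_of_mul hdz) h2

end SolvesRHP

lemma lie_sigma3_mul_diagInv (A : Matrix (Fin 2) (Fin 2) ℂ) (a : ℂ) :
    ⁅sigma3, A * diagInv a⁆ = ⁅sigma3, A⁆ * diagInv a := by
  have h : diagInv a * sigma3 = sigma3 * diagInv a := by
    rw [diagInv, sigma3]
    ext i j
    fin_cases i <;> fin_cases j <;> simp [Matrix.mul_apply, Fin.sum_univ_two]
  rw [Ring.lie_def, Ring.lie_def, sub_mul, mul_assoc A, h]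
  simp only [mul_assoc]

end SpectralData

end DiracRHP

end

/-! ### Periodicity of q -/

theorem mainTheorem5 (S : DiracRHP.SpectralData) (hS : S.IsCandidate)
    (Φ : ℝ → ℝ → ℂ → Matrix (Fin 2) (Fin 2) ℂ) (hΦ : ∀ x t : ℝ, S.SolvesRHP x t (Φ x t))
    (q : ℝ → ℝ → ℂ) (hq : ∀ x t : ℝ, S.Reconstructs (Φ x t) (q x t))
    (L₁ : ℝ) (hL₁ : 0 < L₁) (hr : ∃ r : ℂ → ℂ, S.SolvesScalarRHP L₁ r) :
    ∀ x t : ℝ, q (x + L₁) t = q x t := by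
  open DiracRHP DiracRHP.SpectralData Complex Filter Topology in
  intro x t
  obtain ⟨r, hr⟩ := hr
  obtain ⟨D, hD, N, hlen⟩ := hr.exists_length_le hS hL₁
  obtain ⟨C, K, hB⟩ := hS.exists_norm_det_B_le hD.le hlen
  have ha := hr.isGauge hS
  have h0 := hq x t (1 / 2) (by norm_num)
  -- Multiplying by the gauge factor, which tends to the identity, leaves the limit at x + L₁
  -- unchanged and turns the expression into the one at x.
  have h1 := (hq (x + L₁) t (1 / 2) (by norm_num)).mul
    (tendsto_diagInv (ha.tendsto.mono_left sectorAtInfty_le) one_ne_zero)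
  rw [diagInv_one, mul_one] at h1
  have hne : ∀ᶠ z in sectorAtInfty (1 / 2), z.im ≠ 0 :=
    sectorAtInfty_le (mem_inf_of_right (mem_principal_self nonreal))
  have h2 := h1.congr' (f₂ := fun z => (I * z) • ⁅sigma3, U⁻¹ * Φ x t z * (S.B z)⁻¹⁆) (by
    filter_upwards [hne, (hΦ x t).eventually_eq_normalized] with z hz hBz
    rw [Matrix.smul_mul, ← lie_sigma3_mul_diagInv,
      ← (hΦ x t).mul_diagInv_eq hS ha (hΦ (x + L₁) t) hB hz]
    congr 2
    have hc : Commute (diagInv (r z * exp (-(I * z * L₁)))) (S.B z)⁻¹ := by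
      have hu := Matrix.invertibleOfIsUnitDet (S.B z) hBz.1.isUnit
      have : Commute (diagInv (r z * exp (-(I * z * L₁)))) (S.B z) := (S.B_mul_diagInv z _).symm
      rw [← Matrix.invOf_eq_nonsing_inv]
      exact this.invOf_right
    rw [mul_assoc, ← hc.eq]
    simp only [mul_assoc])
  have := congrFun (congrFun (tendsto_nhds_unique (X := Matrix (Fin 2) (Fin 2) ℂ) h2 h0) 0) 1
  simpa using this
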